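/- Let $W=(W^1,\dots,W^d)$ be a $d$-dimensional standard Brownian motion on a probability space $(\Omega,\mathcal F,P)$, with the $P$-completed filtration it generates. Let $T>0$, let $\sigma_1,\dots,\sigma_d$ be nonzero real constants, let $z_1,\dots,z_d>0$, and let $S=(S^1,\dots,S^d)$ be the (continuous, adapted) solution on $[0,T]$ of $$dS^i_t=\sigma_i\,S^i_t\,dW^i_t,\qquad S^i_0=z_i,\qquad i=1,\dots,d,$$ that is, of $dS^i_t=S^i_t\sum_j\sigma_{ij}\,dW^j_t$ with $\sigma_{ij}=\sigma_i\delta_{ij}$. Let $H=1_{[0,\infty)}$ be the Heaviside function, let $0<s<t\le T$, and let $g:\mathbb R^d\to\mathbb R$ be a measurable function of polynomial growth, i.e. $|g(y)|\le C(1+|y|)^m$ for all $y$, for some $C>0$ and $m\in\mathbb N$. For $f\in\{g,1\}$ and $x\in(0,\infty)^d$ put $$T_{s,t}[f](x)=E\left(f(S_t)\prod_{k=1}^d\frac{H(S^k_s-x_k)\,W^k_{s,t}}{\sigma_k\,s\,(t-s)\,S^k_s}\right),\qquad W^k_{s,t}=(t-s)(W^k_s+\sigma_k s)-s(W^k_t-W^k_s).$$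 Then, for every $x\in(0,\infty)^d$, these expectations are finite (the random variables are integrable), $T_{s,t}[1](x)\neq0$, and $$E\big(g(S_t)\,\big|\,S_s=x\big)=\frac{T_{s,t}[g](x)}{T_{s,t}[1](x)}.$$ Here the left side at the point $x$ means $\lim_{\varepsilon\downarrow0}E\big(g(S_t)1_{\{S_s\in B(x,\varepsilon)\}}\big)/P\big(S_s\in B(x,\varepsilon)\big)$, where $B(x,\varepsilon)=\{y:\max_k|y_k-x_k|<\varepsilon\}$, the denominators are positive and $g(S_t)$ is integrable; and the right side is also a version of the conditional expectation: almost surely, $E(g(S_t)\mid\sigma(S_s))=\big(T_{s,t}[g]/T_{s,t}[1]\big)(S_s)$. -/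

import Mathlib

open MeasureTheory ProbabilityTheory Filter Topology
open scoped NNReal ENNReal

namespace MEDC

noncomputable section

/-- `W = (W¹, …, W^d)` is a `d`-dimensional standard Brownian motion under `P`: the coordinates are
real standard Brownian motions and they are independent as processes. -/
structure IsStandardBrownian {Ω : Type*} [MeasurableSpace Ω] {d : ℕ} (P : Measure Ω)
    (W : Fin d → ℝ≥0 → Ω → ℝ) : Prop where
  measurable : ∀ k u, Measurable (W k u)
  brownian : ∀ k, IsBrownianReal (W k) P
  indep : iIndepFun (fun k ω (u : ℝ≥0) ↦ W k u ω) P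

/-- The filtration generated by `W` and the `P`-null events: `F_u` is generated by
`(W¹_r, …, W^d_r)`, `r ≤ u`, and by all events of probability zero. -/
def brownianFiltration {Ω : Type*} [mΩ : MeasurableSpace Ω] {d : ℕ} (P : Measure Ω)
    (W : Fin d → ℝ≥0 → Ω → ℝ) (hW : ∀ k u, Measurable (W k u)) : Filtration ℝ≥0 mΩ where
  seq u := (⨆ k, ⨆ r, ⨆ (_ : r ≤ u), MeasurableSpace.comap (W k r) inferInstance) ⊔
    MeasurableSpace.generateFrom {A | MeasurableSet A ∧ P A = 0}
  mono' u v huv := by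
    refine sup_le_sup_right ?_ _
    refine iSup_mono fun k ↦ iSup_mono fun r ↦ ?_
    exact iSup_le fun hr ↦ le_iSup_of_le (hr.trans huv) le_rfl
  le' u := by
    refine sup_le ?_ (MeasurableSpace.generateFrom_le fun A hA ↦ hA.1)
    exact iSup_le fun k ↦ iSup_le fun r ↦ iSup_le fun _ ↦ (hW k r).comap_le

/-- A simple process `∑_{i < n} ξ_i 1_{(t_i, t_{i+1}]}`, with `t_0 ≤ t_1 ≤ ⋯` deterministic and
`ξ_i` bounded and `F_{t_i}`-measurable. -/
structure SimpleProcess {Ω : Type*} [mΩ : MeasurableSpace Ω] (F : Filtration ℝ≥0 mΩ) where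
  n : ℕ
  time : ℕ → ℝ≥0
  time_mono : Monotone time
  coef : ℕ → Ω → ℝ
  coef_meas : ∀ i, Measurable[F (time i)] (coef i)
  coef_bdd : ∀ i, ∃ C : ℝ, ∀ ω, |coef i ω| ≤ C

/-- The value at time `u` of a simple process. -/
def SimpleProcess.eval {Ω : Type*} [mΩ : MeasurableSpace Ω] {F : Filtration ℝ≥0 mΩ}
    (H : SimpleProcess F) (u : ℝ≥0) (ω : Ω) : ℝ :=
  ∑ i ∈ Finset.range H.n, (Set.Ioc (H.time i) (H.time (i + 1))).indicator (fun _ ↦ H.coef i ω) u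

/-- The integral over `[0, t]` of a simple process against `B`. -/
def SimpleProcess.integral {Ω : Type*} [mΩ : MeasurableSpace Ω] {F : Filtration ℝ≥0 mΩ}
    (H : SimpleProcess F) (B : ℝ≥0 → Ω → ℝ) (t : ℝ≥0) (ω : Ω) : ℝ :=
  ∑ i ∈ Finset.range H.n,
    H.coef i ω * (B (min (H.time (i + 1)) t) ω - B (min (H.time i) t) ω)

/-- `I` is (a version of) the Itô integral `∫_0^t H_u dB_u`: `H` is adapted with measurable paths,
and there are simple processes `H^n` with `∫_0^t (H^n_u - H_u)² du → 0` and
`∫_0^t H^n_u dB_u → I`, both in probability. -/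
def IsItoIntegral {Ω : Type*} [mΩ : MeasurableSpace Ω] (P : Measure Ω) (F : Filtration ℝ≥0 mΩ)
    (B : ℝ≥0 → Ω → ℝ) (H : ℝ≥0 → Ω → ℝ) (t : ℝ≥0) (I : Ω → ℝ) : Prop :=
  (∀ u ≤ t, Measurable[F u] (H u)) ∧
  (∀ᵐ ω ∂P, AEMeasurable (fun u : ℝ ↦ H u.toNNReal ω) (volume.restrict (Set.Icc 0 (t : ℝ)))) ∧
  ∃ A : ℕ → SimpleProcess F,
    (∀ ε : ℝ≥0∞, 0 < ε → Tendsto (fun n ↦ P {ω | ε ≤ ∫⁻ u in Set.Icc 0 (t : ℝ),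
      ENNReal.ofReal (((A n).eval u.toNNReal ω - H u.toNNReal ω) ^ 2)}) atTop (𝓝 0)) ∧
    TendstoInMeasure P (fun n ↦ (A n).integral B t) atTop I

/-- `S = (S¹, …, S^d)` is a continuous adapted solution on `[0, T]` of the system
`dS^i_t = S^i_t ∑_j σ_ij(t) dW^j_t`, `S^i_0 = z_i`, `1 ≤ i ≤ d`. -/
structure IsSolution {Ω : Type*} [mΩ : MeasurableSpace Ω] {d : ℕ} (P : Measure Ω)
    (F : Filtration ℝ≥0 mΩ) (W : Fin d → ℝ≥0 → Ω → ℝ)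
    (σ : ℝ≥0 → Matrix (Fin d) (Fin d) ℝ) (z : Fin d → ℝ) (T : ℝ≥0)
    (S : Fin d → ℝ≥0 → Ω → ℝ) : Prop where
  adapted : ∀ i, ∀ u ≤ T, Measurable[F u] (S i u)
  continuous : ∀ i, ∀ᵐ ω ∂P, ContinuousOn (fun u ↦ S i u ω) (Set.Iic T)
  equation : ∀ i, ∀ t ≤ T, ∃ I : Fin d → Ω → ℝ,
    (∀ j, IsItoIntegral P F (W j) (fun u ω ↦ S i u ω * σ u i j) t (I j)) ∧
    ∀ᵐ ω ∂P, S i t ω = z i + ∑ j, I j ω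

/-- Measurable functions on `ℝ^d` of polynomial growth (all norms on `ℝ^d` give the same class). -/
def PolyGrowth {d : ℕ} (f : (Fin d → ℝ) → ℝ) : Prop :=
  Measurable f ∧ ∃ C > 0, ∃ m : ℕ, ∀ y, |f y| ≤ C * (1 + ‖y‖) ^ m

/-- The Heaviside function `1_{y ≥ 0}`. -/
def heaviside (y : ℝ) : ℝ := if 0 ≤ y then 1 else 0

/-- `W^k_{s,t} = (t - s)(W^k_s + σ_k s) - s(W^k_t - W^k_s)`. -/
def bridgeWeight {Ω : Type*} {d : ℕ} (W : Fin d → ℝ≥0 → Ω → ℝ) (σ : Fin d → ℝ) (s t : ℝ≥0)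
    (k : Fin d) (ω : Ω) : ℝ :=
  ((t : ℝ) - s) * (W k s ω + σ k * s) - s * (W k t ω - W k s ω)

/-- The random variable under the expectation defining `T_{s,t}[f](x)`. -/
def opIntegrand {Ω : Type*} {d : ℕ} (W S : Fin d → ℝ≥0 → Ω → ℝ) (σ : Fin d → ℝ) (s t : ℝ≥0)
    (f : (Fin d → ℝ) → ℝ) (x : Fin d → ℝ) (ω : Ω) : ℝ :=
  f (fun k ↦ S k t ω) *
    ∏ k, heaviside (S k s ω - x k) * bridgeWeight W σ s t k ω /
      (σ k * s * ((t : ℝ) - s) * S k s ω)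

/-- `T_{s,t}[f](x) = E (f(S_t) ∏_k H(S^k_s - x_k) W^k_{s,t} / (σ_k s (t - s) S^k_s))`. -/
def op {Ω : Type*} [MeasurableSpace Ω] {d : ℕ} (P : Measure Ω) (W S : Fin d → ℝ≥0 → Ω → ℝ)
    (σ : Fin d → ℝ) (s t : ℝ≥0) (f : (Fin d → ℝ) → ℝ) (x : Fin d → ℝ) : ℝ :=
  ∫ ω, opIntegrand W S σ s t f x ω ∂P

/-- `E (Y | X = x) = c` at the individual point `x`: `x` is in the support of the law of `X` and
`c` is the limit, as `ε ↓ 0`, of the elementary conditional expectations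
`E (Y 1_{X ∈ B(x, ε)}) / P (X ∈ B(x, ε))`. -/
def HasCondExpAt {Ω E : Type*} [MeasurableSpace Ω] [PseudoMetricSpace E] (P : Measure Ω)
    (Y : Ω → ℝ) (X : Ω → E) (x : E) (c : ℝ) : Prop :=
  Integrable Y P ∧ (∀ ε > 0, 0 < P (X ⁻¹' Metric.ball x ε)) ∧
    Tendsto (fun ε : ℝ ↦ (∫ ω in X ⁻¹' Metric.ball x ε, Y ω ∂P) / P.real (X ⁻¹' Metric.ball x ε))
      (𝓝[>] 0) (𝓝 c)

end

end MEDC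

/-! The equation forces $S^k_r=z_ke^{\sigma_kW^k_r-\sigma_k^2r/2}$, so $S_s$ is an invertible
function of $W_s$ and everything becomes a Gaussian computation in the independent pair
$(W_s,W_t-W_s)$. Put $v=t-s$, let $p_r$ be the density of $N(0,r)$, and let $a$ be the value of
$W_s$ at which $S_s=x$.

Hold the terminal value $u=W_t$ fixed. In each coordinate $p_s(y)p_v(u-y)$ times the weight without
its Heaviside factor is the $y$-derivative of $-p_s(y)p_v(u-y)/(\sigma S_s(y))$. The Heaviside
factor cuts the integral off at $a$, so only the boundary term $p_s(a)p_v(u-a)/(|\sigma|x)$ survives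
(`integral_heaviside_weight`). As $f(S_t)$ depends on $u$ alone, $T_{s,t}[f](x)=q(x)\Gamma_f(a)$,
where $q(x)=\prod_kp_s(a_k)/(|\sigma_k|x_k)>0$ is the density of $S_s$ and $\Gamma_f(a)$ is the mean
of $f(S_t)$ given $W_s=a$ (`PolyGrowth.integral_mul_weightProd`). Since $\Gamma_1=1$, the ratio is
$\Gamma_g(a)$. Gaussian smoothing makes $\Gamma_g$ continuous
(`PolyGrowth.continuous_transitionMean`), and a version of the conditional expectation continuous at
$x$ determines the limit over shrinking balls.

The explicit form of $S$ is a uniqueness statement (`IsSolution.ae_eq_expMartingale`). An Itô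
integral of a process with continuous paths is a limit of left-point sums along partitions adapted
to the approximating simple processes (`IsItoIntegral.exists_tendsto_leftSum`). The exponential
martingale satisfies the equation along any partitions of vanishing mesh, so the difference $D$ from
$S$ is a limit of left-point sums of $\sigma D\,dB$. Truncating to paths bounded by $K$ and
iterating the isometry bounds the second moment by $K^2(\sigma^2u)^n/n!$ for every $n$, whence
$D=0$. -/

namespace MEDC

/-! ### Independence of Brownian increments from the completed past -/

section Independence

variable {Ω : Type*} {mΩ : MeasurableSpace Ω} {P : Measure Ω}

/-- Adding to `m₂` a σ-algebra independent of `m₁ ⊔ m₂` preserves independence from `m₁`. -/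
lemma indep_sup_right_of_indep_sup_left [IsProbabilityMeasure P] {m₁ m₂ m₃ : MeasurableSpace Ω}
    (h₁ : m₁ ≤ mΩ) (h₂ : m₂ ≤ mΩ) (h₃ : m₃ ≤ mΩ) (h₁₂ : Indep m₁ m₂ P)
    (h : Indep (m₁ ⊔ m₂) m₃ P) : Indep m₁ (m₂ ⊔ m₃) P := by
  -- Intersections of an event of `m₂` with one of `m₃` form a π-system generating the join, so
  -- independence need only be tested on them.
  set p : Set (Set Ω) := {C | ∃ A B, MeasurableSet[m₂] A ∧ MeasurableSet[m₃] B ∧ C = A ∩ B} with hp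
  refine IndepSets.indep (p1 := {A | MeasurableSet[m₁] A}) (p2 := p) h₁ (sup_le h₂ h₃)
    (@MeasurableSpace.isPiSystem_measurableSet Ω m₁) ?_
    (@MeasurableSpace.generateFrom_measurableSet Ω m₁).symm ?_ ?_
  · rintro _ ⟨A, B, hA, hB, rfl⟩ _ ⟨A', B', hA', hB', rfl⟩ _
    exact ⟨A ∩ A', B ∩ B', @MeasurableSet.inter _ m₂ _ _ hA hA',
      @MeasurableSet.inter _ m₃ _ _ hB hB',
      Set.inter_inter_inter_comm _ _ _ _⟩
  · refine le_antisymm (sup_le ?_ ?_) (MeasurableSpace.generateFrom_le ?_)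
    · exact fun A hA ↦ MeasurableSpace.measurableSet_generateFrom
        ⟨A, Set.univ, hA, @MeasurableSet.univ _ m₃, by simp⟩
    · exact fun A hA ↦ MeasurableSpace.measurableSet_generateFrom
        ⟨Set.univ, A, @MeasurableSet.univ _ m₂, hA, by simp⟩
    · rintro _ ⟨A, B, hA, hB, rfl⟩
      exact @MeasurableSet.inter _ (m₂ ⊔ m₃) _ _ ((le_sup_left : m₂ ≤ m₂ ⊔ m₃) _ hA)
        ((le_sup_right : m₃ ≤ m₂ ⊔ m₃) _ hB)
  · rw [IndepSets_iff]
    rintro C _ hC ⟨A, B, hA, hB, rfl⟩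
    rw [Indep_iff] at h h₁₂
    have hC' : MeasurableSet[m₁ ⊔ m₂] C := (le_sup_left : m₁ ≤ m₁ ⊔ m₂) _ hC
    have hA' : MeasurableSet[m₁ ⊔ m₂] A := (le_sup_right : m₂ ≤ m₁ ⊔ m₂) _ hA
    rw [← Set.inter_assoc, h _ _ (@MeasurableSet.inter _ (m₁ ⊔ m₂) _ _ hC' hA') hB, h₁₂ _ _ hC hA,
      h _ _ hA' hB, mul_assoc]

/-- Independence is insensitive to the adjunction of null events. -/
lemma indep_sup_null {m₁ m₂ : MeasurableSpace Ω} (h : Indep m₁ m₂ P) :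
    Indep m₁ (m₂ ⊔ MeasurableSpace.generateFrom {A | MeasurableSet[mΩ] A ∧ P A = 0}) P := by
  -- Every event of the enlarged σ-algebra agrees almost surely with an event of `m₂`, and
  -- probabilities do not see the difference.
  have hle : m₂ ⊔ MeasurableSpace.generateFrom {A | MeasurableSet[mΩ] A ∧ P A = 0} ≤
      eventuallyMeasurableSpace m₂ (ae P) := by
    refine sup_le le_eventuallyMeasurableSpace (MeasurableSpace.generateFrom_le ?_)
    rintro A ⟨-, hA⟩
    exact ⟨∅, @MeasurableSet.empty _ m₂, ae_eq_empty.2 hA⟩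
  rw [Indep_iff] at h ⊢
  intro A B hA hB
  obtain ⟨C, hC, hBC⟩ := hle _ hB
  rw [measure_congr ((ae_eq_refl A).inter hBC), measure_congr hBC, h _ _ hA hC]

/-- The increments of a coordinate after time `u` are independent of the past up to `u`. -/
lemma IsStandardBrownian.indep_increment [IsProbabilityMeasure P] {d : ℕ}
    {W : Fin d → ℝ≥0 → Ω → ℝ} (hW : IsStandardBrownian P W) (j : Fin d) {u v : ℝ≥0}
    (huv : u ≤ v) :
    Indep (MeasurableSpace.comap (fun ω ↦ W j v ω - W j u ω) inferInstance)
      (brownianFiltration P W hW.measurable u) P := by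
  change Indep _ ((⨆ k, ⨆ r, ⨆ (_ : r ≤ u), MeasurableSpace.comap (W k r) inferInstance) ⊔
    MeasurableSpace.generateFrom {A | MeasurableSet A ∧ P A = 0}) P
  refine indep_sup_null ?_
  set path : Fin d → Ω → ℝ≥0 → ℝ := fun k ω u ↦ W k u ω
  have hpath k : Measurable (path k) := measurable_pi_lambda _ fun r ↦ hW.measurable k r
  set mp : Fin d → MeasurableSpace Ω := fun k ↦ MeasurableSpace.comap (path k) inferInstance
  have hmp k : mp k ≤ mΩ := (hpath k).comap_le
  have hcoord k r : MeasurableSpace.comap (W k r) inferInstance ≤ mp k := by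
    have : W k r = (fun x : ℝ≥0 → ℝ ↦ x r) ∘ path k := rfl
    rw [this, ← MeasurableSpace.comap_comp]
    exact MeasurableSpace.comap_mono (measurable_pi_apply r).comap_le
  have hWmp r : Measurable[mp j] (W j r) :=
    (measurable_pi_apply r).comp (comap_measurable (path j))
  have h₁₂ : Indep (MeasurableSpace.comap (fun ω ↦ W j v ω - W j u ω) inferInstance)
      (MeasurableSpace.comap (fun ω (r : Set.Iic u) ↦ W j r ω) inferInstance) P := by
    have h := (hW.brownian j).indepFun_shift u
    have h' := h.comp (measurable_pi_apply (v - u)) measurable_id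
    rw [IndepFun_iff_Indep] at h'
    convert h' using 2
    · funext ω
      simp [add_tsub_cancel_of_le huv]
    · rfl
  have h₁ : MeasurableSpace.comap (fun ω ↦ W j v ω - W j u ω) inferInstance ≤ mp j := by
    refine Measurable.comap_le ?_
    exact (hWmp v).sub (hWmp u)
  have h₂ : MeasurableSpace.comap (fun ω (r : Set.Iic u) ↦ W j r ω) inferInstance ≤ mp j := by
    refine Measurable.comap_le ?_
    exact @measurable_pi_lambda _ _ _ (mp j) _ _ fun r ↦ hWmp r
  have hind : Indep (mp j) (⨆ k ∈ ({j}ᶜ : Set (Fin d)), mp k) P := by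
    have := indep_iSup_of_disjoint hmp hW.indep.iIndep
      (S := {j}) (T := {j}ᶜ) disjoint_compl_right
    simpa using this
  have h₃ : (⨆ k ∈ ({j}ᶜ : Set (Fin d)), mp k) ≤ mΩ := iSup₂_le fun k _ ↦ hmp k
  -- The past up to `u` lies in the join of the past of coordinate `j`, independent of the increment
  -- by the one-dimensional theory, with the whole paths of the other coordinates, independent of
  -- path `j`.
  have hfin := indep_sup_right_of_indep_sup_left (h₁.trans (hmp j)) (h₂.trans (hmp j)) h₃ h₁₂
    (indep_of_indep_of_le_left hind (sup_le h₁ h₂))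
  refine indep_of_indep_of_le_right hfin ?_
  refine iSup_le fun k ↦ iSup_le fun r ↦ iSup_le fun hr ↦ ?_
  by_cases hk : k = j
  · subst hk
    refine le_sup_of_le_left ?_
    have : W k r = (fun x : Set.Iic u → ℝ ↦ x ⟨r, hr⟩) ∘ (fun ω (r : Set.Iic u) ↦ W k r ω) := rfl
    rw [this, ← MeasurableSpace.comap_comp]
    exact MeasurableSpace.comap_mono (measurable_pi_apply _).comap_le
  · exact le_sup_of_le_right ((hcoord k r).trans (le_iSup₂_of_le k hk le_rfl))

lemma measurable_brownianFiltration {d : ℕ} {W : Fin d → ℝ≥0 → Ω → ℝ}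
    (hW : ∀ k u, Measurable (W k u)) (k : Fin d) {r u : ℝ≥0} (hr : r ≤ u) :
    Measurable[brownianFiltration P W hW u] (W k r) := by
  rw [measurable_iff_comap_le]
  exact le_sup_of_le_left (le_iSup_of_le k (le_iSup_of_le r (le_iSup_of_le hr le_rfl)))

end Independence

/-! ### Itô isometry and a bound in probability for step processes -/

section Isometry

variable {Ω : Type*} {mΩ : MeasurableSpace Ω} {P : Measure Ω} {F : Filtration ℝ≥0 mΩ}

/-- `B` is a continuous Brownian motion relative to the filtration `F`. -/
structure IsBrownianWrt (P : Measure Ω) (F : Filtration ℝ≥0 mΩ) (B : ℝ≥0 → Ω → ℝ) : Prop where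
  measurable : ∀ u, Measurable[F u] (B u)
  hasLaw : ∀ u v, u ≤ v → HasLaw (fun ω ↦ B v ω - B u ω) (gaussianReal 0 (v - u)) P
  indep : ∀ u v, u ≤ v →
    Indep (MeasurableSpace.comap (fun ω ↦ B v ω - B u ω) inferInstance) (F u) P
  zero : ∀ᵐ ω ∂P, B 0 ω = 0
  cont : ∀ᵐ ω ∂P, Continuous fun u ↦ B u ω

lemma IsStandardBrownian.isBrownianWrt [IsProbabilityMeasure P] {d : ℕ}
    {W : Fin d → ℝ≥0 → Ω → ℝ} (hW : IsStandardBrownian P W) (j : Fin d) :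
    IsBrownianWrt P (brownianFiltration P W hW.measurable) (W j) where
  measurable _ := measurable_brownianFiltration hW.measurable j le_rfl
  hasLaw u v huv := by
    have h := (hW.brownian j).hasLaw_sub v u
    have e : nndist v.1 u.1 = v - u := by
      rw [← NNReal.coe_inj, coe_nndist, Real.dist_eq, NNReal.coe_sub huv, abs_of_nonneg]
      · rfl
      · exact sub_nonneg.2 huv
    rw [e] at h
    exact h
  indep _ _ huv := hW.indep_increment j huv
  zero := (hW.brownian j).eval_zero_ae_eq_zero
  cont := (hW.brownian j).cont

/-- Orthogonality of martingale increments `c_j ξ_j`, where `ξ_j` is centred and independent of the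
past, to which `c_j` belongs. -/
lemma integral_sq_sum_mul [IsProbabilityMeasure P] {τ : ℕ → ℝ≥0} (hτ : Monotone τ)
    {c ξ : ℕ → Ω → ℝ} {v : ℕ → ℝ} (hc : ∀ j, Measurable[F (τ j)] (c j))
    (hc2 : ∀ j, MemLp (c j) 2 P) (hξ : ∀ j, Measurable[F (τ (j + 1))] (ξ j))
    (hξ2 : ∀ j, MemLp (ξ j) 2 P) (hmean : ∀ j, ∫ ω, ξ j ω ∂P = 0)
    (hvar : ∀ j, ∫ ω, ξ j ω ^ 2 ∂P = v j)
    (hind : ∀ j, Indep (MeasurableSpace.comap (ξ j) inferInstance) (F (τ j)) P) (N : ℕ) :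
    MemLp (fun ω ↦ ∑ j ∈ Finset.range N, c j ω * ξ j ω) 2 P ∧
      ∫ ω, (∑ j ∈ Finset.range N, c j ω * ξ j ω) ^ 2 ∂P =
        ∑ j ∈ Finset.range N, (∫ ω, c j ω ^ 2 ∂P) * v j := by
  have hind' (j : ℕ) (Y : Ω → ℝ) (hY : Measurable[F (τ j)] Y) : IndepFun Y (ξ j) P := by
    rw [IndepFun_iff_Indep]
    exact (indep_of_indep_of_le_right (hind j) hY.comap_le).symm
  have hprod (j : ℕ) : MemLp (fun ω ↦ c j ω * ξ j ω) 2 P := by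
    refine (memLp_two_iff_integrable_sq
      ((hc2 j).aestronglyMeasurable.mul (hξ2 j).aestronglyMeasurable)).2 ?_
    have h := ((hind' j _ (hc j)).comp (measurable_id.pow_const 2)
      (measurable_id.pow_const 2)).integrable_mul (hc2 j).integrable_sq (hξ2 j).integrable_sq
    refine h.congr (ae_of_all _ fun ω ↦ ?_)
    simp [mul_pow]
  have hmeas (N : ℕ) : Measurable[F (τ N)] fun ω ↦ ∑ j ∈ Finset.range N, c j ω * ξ j ω := by
    refine Finset.measurable_fun_sum _ fun j hj ↦ ?_
    have hj' : j + 1 ≤ N := Finset.mem_range.1 hj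
    exact ((hc j).mono (F.mono (hτ (by lia))) le_rfl).mul
      ((hξ j).mono (F.mono (hτ hj')) le_rfl)
  induction N with
  | zero => simp
  | succ N ih =>
    obtain ⟨ih2, ihs⟩ := ih
    have hM := hmeas N
    set M : Ω → ℝ := fun ω ↦ ∑ j ∈ Finset.range N, c j ω * ξ j ω with hMdef
    have hsum : (fun ω ↦ ∑ j ∈ Finset.range (N + 1), c j ω * ξ j ω) =
        fun ω ↦ M ω + c N ω * ξ N ω := by
      funext ω; rw [Finset.sum_range_succ]
    refine ⟨by rw [hsum]; exact ih2.add (hprod N), ?_⟩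
    have hMc : Integrable (fun ω ↦ M ω * c N ω) P := ih2.integrable_mul (hc2 N)
    -- `M` and `c N` are known at time `τ N`, while `ξ N` is centred and independent of that past.
    have hcross : ∫ ω, M ω * c N ω * ξ N ω ∂P = 0 := by
      have h := (hind' N _ (hM.mul (hc N))).integral_fun_mul_eq_mul_integral
        hMc.aestronglyMeasurable (hξ2 N).aestronglyMeasurable
      rw [hmean, mul_zero] at h
      exact h
    have hcrossi : Integrable (fun ω ↦ M ω * c N ω * ξ N ω) P :=
      (hind' N _ (hM.mul (hc N))).integrable_mul hMc ((hξ2 N).integrable one_le_two)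
    have hdiag : ∫ ω, (c N ω * ξ N ω) ^ 2 ∂P = (∫ ω, c N ω ^ 2 ∂P) * v N := by
      have h := ((hind' N _ (hc N)).comp (measurable_id.pow_const 2)
        (measurable_id.pow_const 2)).integral_mul_eq_mul_integral
          (hc2 N).integrable_sq.aestronglyMeasurable (hξ2 N).integrable_sq.aestronglyMeasurable
      rw [← hvar N]
      simpa [mul_pow, Function.comp_def] using h
    have e : ∀ ω, (∑ j ∈ Finset.range (N + 1), c j ω * ξ j ω) ^ 2 =
        M ω ^ 2 + 2 * (M ω * c N ω * ξ N ω) + (c N ω * ξ N ω) ^ 2 := by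
      intro ω; rw [Finset.sum_range_succ]; simp only [hMdef]; ring
    simp_rw [e]
    have hadd : Integrable (fun ω ↦ M ω ^ 2 + 2 * (M ω * c N ω * ξ N ω)) P :=
      ih2.integrable_sq.add (hcrossi.const_mul 2)
    rw [integral_add hadd (hprod N).integrable_sq, integral_add ih2.integrable_sq
      (hcrossi.const_mul 2), integral_const_mul, hcross, hdiag, ihs,
      Finset.sum_range_succ]
    ring

lemma IsBrownianWrt.memLp_increment {B : ℝ≥0 → Ω → ℝ} (hB : IsBrownianWrt P F B) {u v : ℝ≥0}
    (huv : u ≤ v) : MemLp (fun ω ↦ B v ω - B u ω) 2 P := by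
  have h := hB.hasLaw u v huv
  have := memLp_id_gaussianReal' (μ := 0) (v := v - u) 2 (by simp)
  rw [← h.map_eq, memLp_map_measure_iff aestronglyMeasurable_id h.aemeasurable] at this
  exact this

lemma IsBrownianWrt.integral_increment {B : ℝ≥0 → Ω → ℝ} (hB : IsBrownianWrt P F B) {u v : ℝ≥0}
    (huv : u ≤ v) : ∫ ω, (B v ω - B u ω) ∂P = 0 := by
  rw [(hB.hasLaw u v huv).integral_eq, integral_id_gaussianReal]

lemma IsBrownianWrt.integral_increment_sq [IsProbabilityMeasure P] {B : ℝ≥0 → Ω → ℝ}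
    (hB : IsBrownianWrt P F B) {u v : ℝ≥0}
    (huv : u ≤ v) : ∫ ω, (B v ω - B u ω) ^ 2 ∂P = (v : ℝ) - u := by
  have h := variance_eq_sub (hB.memLp_increment huv)
  rw [(hB.hasLaw u v huv).variance_eq, variance_id_gaussianReal, hB.integral_increment huv] at h
  simp only [Pi.pow_apply] at h
  rw [NNReal.coe_sub huv] at h
  linarith

/-- Itô isometry for step processes with square integrable coefficients. -/
lemma IsBrownianWrt.integral_sq_sum [IsProbabilityMeasure P] {B : ℝ≥0 → Ω → ℝ}
    (hB : IsBrownianWrt P F B) {τ : ℕ → ℝ≥0} (hτ : Monotone τ) {c : ℕ → Ω → ℝ}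
    (hc : ∀ j, Measurable[F (τ j)] (c j)) (hc2 : ∀ j, MemLp (c j) 2 P) (N : ℕ) :
    MemLp (fun ω ↦ ∑ j ∈ Finset.range N, c j ω * (B (τ (j + 1)) ω - B (τ j) ω)) 2 P ∧
      ∫ ω, (∑ j ∈ Finset.range N, c j ω * (B (τ (j + 1)) ω - B (τ j) ω)) ^ 2 ∂P =
        ∑ j ∈ Finset.range N, (∫ ω, c j ω ^ 2 ∂P) * ((τ (j + 1) : ℝ) - τ j) :=
  integral_sq_sum_mul (ξ := fun j ω ↦ B (τ (j + 1)) ω - B (τ j) ω) hτ hc hc2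
    (fun j ↦ (hB.measurable _).sub
      ((hB.measurable (τ j)).mono (F.mono (hτ (Nat.le_succ j))) le_rfl))
    (fun j ↦ hB.memLp_increment (hτ (Nat.le_succ j)))
    (fun j ↦ hB.integral_increment (hτ (Nat.le_succ j)))
    (fun j ↦ hB.integral_increment_sq (hτ (Nat.le_succ j)))
    (fun j ↦ hB.indep _ _ (hτ (Nat.le_succ j))) N

lemma measure_abs_ge_le_of_integral_sq_le [IsProbabilityMeasure P] {X : Ω → ℝ} (hX : MemLp X 2 P)
    {δ ε : ℝ} (hε : 0 < ε) (h : ∫ ω, X ω ^ 2 ∂P ≤ δ) :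
    P {ω | ε ≤ |X ω|} ≤ ENNReal.ofReal (δ / ε ^ 2) := by
  have h1 := mul_meas_ge_le_integral_of_nonneg (μ := P) (ae_of_all _ fun ω ↦ sq_nonneg (X ω))
    hX.integrable_sq (ε ^ 2)
  have h2 : {ω | ε ≤ |X ω|} = {ω | ε ^ 2 ≤ X ω ^ 2} := by
    ext ω
    simp only [Set.mem_ofPred_eq]
    rw [← sq_abs (X ω), pow_le_pow_iff_left₀ hε.le (abs_nonneg _) two_ne_zero]
  rw [h2, ← ENNReal.ofReal_toReal (measure_ne_top P _)]
  refine ENNReal.ofReal_le_ofReal ?_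
  rw [le_div_iff₀ (by positivity), mul_comm]
  exact h1.trans h

/-- A step process with small square integral has a small stochastic integral. -/
lemma IsBrownianWrt.measure_abs_sum_ge_le [IsProbabilityMeasure P] {B : ℝ≥0 → Ω → ℝ}
    (hB : IsBrownianWrt P F B) {τ : ℕ → ℝ≥0} (hτ : Monotone τ) {c : ℕ → Ω → ℝ}
    (hc : ∀ j, Measurable[F (τ j)] (c j)) (N : ℕ) {δ ε : ℝ} (hδ : 0 < δ) (hε : 0 < ε) :
    P {ω | ε ≤ |∑ j ∈ Finset.range N, c j ω * (B (τ (j + 1)) ω - B (τ j) ω)|} ≤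
      P {ω | δ ≤ ∑ j ∈ Finset.range N, c j ω ^ 2 * ((τ (j + 1) : ℝ) - τ j)} +
        ENNReal.ofReal (δ / ε ^ 2) := by
  classical
  have hΔ j : 0 ≤ (τ (j + 1) : ℝ) - τ j := sub_nonneg.2 (hτ (Nat.le_succ j))
  set s : ℕ → Ω → ℝ := fun n ω ↦ ∑ j ∈ Finset.range n, c j ω ^ 2 * ((τ (j + 1) : ℝ) - τ j) with hs
  have hterm j ω : 0 ≤ c j ω ^ 2 * ((τ (j + 1) : ℝ) - τ j) := mul_nonneg (sq_nonneg _) (hΔ j)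
  have hsmono ω : Monotone fun n ↦ s n ω := by
    refine monotone_nat_of_le_succ fun n ↦ ?_
    simp only [hs, Finset.sum_range_succ]
    linarith [hterm n ω]
  -- The `c j` need not be square integrable, so they are switched off once the accumulated square
  -- sum reaches `δ`. The sum `s (j + 1)` involves only `c 0, …, c j`, hence is known at time `τ j`,
  -- and `b` stays adapted. Cells of length zero are dropped because the sum does not control the
  -- coefficient there.
  set b : ℕ → Ω → ℝ := fun j ω ↦ if τ j < τ (j + 1) ∧ s (j + 1) ω < δ then c j ω else 0 with hb
  have hsmeas j : Measurable[F (τ j)] (s (j + 1)) := by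
    refine Finset.measurable_fun_sum _ fun i hi ↦ ?_
    have hi' : i ≤ j := Nat.lt_succ_iff.1 (Finset.mem_range.1 hi)
    exact (((hc i).mono (F.mono (hτ hi')) le_rfl).pow_const 2).mul_const _
  have hbm j : Measurable[F (τ j)] (b j) := by
    refine Measurable.ite ?_ (hc j) measurable_const
    by_cases h : τ j < τ (j + 1)
    · simp only [h, true_and]
      exact measurableSet_lt (hsmeas j) measurable_const
    · simp [h]
  have hbb j ω : |b j ω| ≤ √(δ / ((τ (j + 1) : ℝ) - τ j)) := by
    simp only [hb]
    split_ifs with h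
    · have hpos : 0 < (τ (j + 1) : ℝ) - τ j := sub_pos.2 h.1
      refine Real.abs_le_sqrt ?_
      rw [le_div_iff₀ hpos]
      have h2 := h.2
      simp only [hs, Finset.sum_range_succ] at h2
      have := Finset.sum_nonneg (s := Finset.range j) fun i _ ↦ hterm i ω
      linarith
    · simp
  have hb2 j : MemLp (b j) 2 P := by
    refine MemLp.of_bound ((hbm j).mono (F.le _) le_rfl).aestronglyMeasurable
      (√(δ / ((τ (j + 1) : ℝ) - τ j))) (ae_of_all _ fun ω ↦ ?_)
    exact hbb j ω
  obtain ⟨hI2, hI⟩ := hB.integral_sq_sum hτ hbm hb2 N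
  have hle ω : ∀ n, ∑ j ∈ Finset.range n, b j ω ^ 2 * ((τ (j + 1) : ℝ) - τ j) ≤ min (s n ω) δ := by
    intro n
    induction n with
    | zero => simp [hs, hδ.le]
    | succ n ih =>
      rw [Finset.sum_range_succ]
      have hs1 : s (n + 1) ω = s n ω + c n ω ^ 2 * ((τ (n + 1) : ℝ) - τ n) := by
        simp only [hs, Finset.sum_range_succ]
      have hbn : b n ω ^ 2 * ((τ (n + 1) : ℝ) - τ n) ≤ c n ω ^ 2 * ((τ (n + 1) : ℝ) - τ n) := by
        simp only [hb]
        split_ifs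
        · exact le_rfl
        · simpa using hterm n ω
      refine le_min ?_ ?_
      · rw [hs1]; exact add_le_add (ih.trans (min_le_left _ _)) hbn
      · by_cases h : s (n + 1) ω < δ
        · exact ((add_le_add (ih.trans (min_le_left _ _)) hbn).trans hs1.ge).trans h.le
        · have : b n ω = 0 := by simp only [hb, h, and_false, if_false]
          simpa only [this, ne_eq, OfNat.ofNat_ne_zero, not_false_eq_true, zero_pow, zero_mul,
            add_zero] using ih.trans (min_le_right _ _)
  have hIle : ∫ ω, (∑ j ∈ Finset.range N, b j ω * (B (τ (j + 1)) ω - B (τ j) ω)) ^ 2 ∂P ≤ δ := by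
    rw [hI]
    have hint j : Integrable (fun ω ↦ b j ω ^ 2 * ((τ (j + 1) : ℝ) - τ j)) P :=
      (hb2 j).integrable_sq.mul_const _
    simp_rw [← integral_mul_const]
    rw [← integral_finsetSum _ fun j _ ↦ hint j]
    calc _ ≤ ∫ _, δ ∂P := integral_mono (integrable_finsetSum _ fun j _ ↦ hint j)
            (integrable_const _) fun ω ↦ (hle ω N).trans (min_le_right _ _)
      _ = δ := by simp
  -- If the full square sum stays below `δ`, the truncation never acts on a cell of positive length
  -- and the two stochastic sums agree.
  refine le_trans (measure_mono ?_) ((measure_union_le _ _).trans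
    (add_le_add_right (measure_abs_ge_le_of_integral_sq_le hI2 hε hIle) _))
  intro ω hω
  by_cases h : δ ≤ s N ω
  · exact Or.inl h
  · refine Or.inr ?_
    have : ∑ j ∈ Finset.range N, b j ω * (B (τ (j + 1)) ω - B (τ j) ω) =
        ∑ j ∈ Finset.range N, c j ω * (B (τ (j + 1)) ω - B (τ j) ω) := by
      refine Finset.sum_congr rfl fun j hj ↦ ?_
      have hj' : s (j + 1) ω < δ := (hsmono ω (Finset.mem_range.1 hj)).trans_lt (not_le.1 h)
      by_cases hlt : τ j < τ (j + 1)
      · simp [hb, hlt, hj']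
      · have : τ (j + 1) = τ j := le_antisymm (not_lt.1 hlt) (hτ (Nat.le_succ j))
        simp [this]
    simpa [this] using hω

end Isometry

/-! ### Partitions compatible with a simple process -/

section Partition

/-- `0 = τ 0 ≤ τ 1 ≤ ⋯ ≤ τ N = t` is a partition of `[0, t]` of mesh at most `h`, continued by the
constant `t`. -/
structure IsPartition (t : ℝ≥0) (h : ℝ) (τ : ℕ → ℝ≥0) (N : ℕ) : Prop where
  mono : Monotone τ
  zero : τ 0 = 0
  last : τ N = t
  le : ∀ j, τ j ≤ t
  mesh : ∀ j, (τ (j + 1) : ℝ) - τ j ≤ h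

/-- Enumerate `X` increasingly and freeze at the last index: consecutive values then have no point
of `X` strictly between them. -/
lemma exists_monotone_avoiding (t : ℝ≥0) (X : Finset ℝ≥0) (h0 : 0 ∈ X) (ht : t ∈ X)
    (hX : ∀ x ∈ X, x ≤ t) :
    ∃ (τ : ℕ → ℝ≥0) (N : ℕ), Monotone τ ∧ τ 0 = 0 ∧ τ N = t ∧ (∀ j, τ j ≤ t) ∧
      ∀ x ∈ X, ∀ j, τ j < x → τ (j + 1) ≤ x := by
  obtain ⟨N, hN⟩ : ∃ N, X.card = N + 1 :=
    Nat.exists_eq_add_one.2 (Finset.card_pos.2 ⟨0, h0⟩)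
  set e := X.orderEmbOfFin hN
  have hlt j : min j N < N + 1 := by lia
  have hmem i : e i ∈ X := Finset.orderEmbOfFin_mem X hN i
  have hsurj x (hx : x ∈ X) : ∃ i, e i = x := by
    have : x ∈ Set.range e := by rw [Finset.range_orderEmbOfFin]; exact hx
    exact this
  refine ⟨fun j ↦ e ⟨min j N, hlt j⟩, N, ?_, ?_, ?_, fun j ↦ hX _ (hmem _), ?_⟩
  · intro i j hij
    exact e.monotone (by simp only [Fin.mk_le_mk]; lia)
  · obtain ⟨i, hi⟩ := hsurj 0 h0
    refine le_antisymm ?_ zero_le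
    rw [← hi]
    exact e.monotone (by simp)
  · obtain ⟨i, hi⟩ := hsurj t ht
    refine le_antisymm (hX _ (hmem _)) ?_
    rw [← hi]
    exact e.monotone (by simp only [Fin.le_def]; lia)
  · intro x hx j hj
    obtain ⟨i, rfl⟩ := hsurj x hx
    have := e.lt_iff_lt.1 hj
    exact e.monotone (by simp only [Fin.le_def, Fin.lt_def] at this ⊢; lia)

/-- Partitions of small mesh which no point of a given finite set cuts. -/
lemma exists_isPartition (t : ℝ≥0) (X : Finset ℝ≥0) {h : ℝ} (hh : 0 < h) :
    ∃ (τ : ℕ → ℝ≥0) (N : ℕ), IsPartition t h τ N ∧ ∀ x ∈ X, ∀ j, x < τ (j + 1) → x ≤ τ j := by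
  classical
  lift h to ℝ≥0 using hh.le
  have hh' : 0 < h := by exact_mod_cast hh
  -- The multiples of `h` control the mesh. The first multiple beyond a point `τ j ≤ t` has index at
  -- most `⌊t / h⌋₊ + 1`, which fixes the range.
  set Y : Finset ℝ≥0 := (X ∪ (Finset.range (⌊t / h⌋₊ + 2)).image (fun i : ℕ ↦ (i : ℝ≥0) * h) ∪
    {0, t}).filter (· ≤ t) with hY
  obtain ⟨τ, N, hmono, h0, hN, hle, hav⟩ := exists_monotone_avoiding t Y (by simp [hY])
    (by simp [hY]) (fun x hx ↦ (Finset.mem_filter.1 hx).2)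
  refine ⟨τ, N, ⟨hmono, h0, hN, hle, fun j ↦ ?_⟩, fun x hx j hxj ↦ ?_⟩
  · set k := ⌊τ j / h⌋₊ + 1 with hk
    have hk1 : τ j < k * h := by
      rw [← div_lt_iff₀ hh', hk]
      exact_mod_cast Nat.lt_floor_add_one _
    have hk2 : k * h ≤ τ j + h := by
      have := Nat.floor_le (a := τ j / h) zero_le
      rw [le_div_iff₀ hh'] at this
      rw [hk]; push_cast; rw [add_mul, one_mul]; gcongr
    have key : τ (j + 1) ≤ τ j + h := by
      by_cases hkt : k * h ≤ t
      · refine (hav (k * h) ?_ j hk1).trans hk2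
        simp only [hY, Finset.mem_filter, Finset.mem_union, Finset.mem_image, Finset.mem_range]
        refine ⟨Or.inl (Or.inr ⟨k, ?_, rfl⟩), hkt⟩
        have : ⌊τ j / h⌋₊ ≤ ⌊t / h⌋₊ := Nat.floor_mono (by gcongr; exact hle j)
        lia
      · exact (hle _).trans ((not_le.1 hkt).le.trans hk2)
    have : (τ (j + 1) : ℝ) ≤ τ j + h := by exact_mod_cast key
    linarith
  · by_contra hcon
    have hxt : x ≤ t := hxj.le.trans (hle _)
    have := hav x (by simp [hY, hx, hxt]) j (not_le.1 hcon)
    exact absurd hxj (not_lt.2 this)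

variable {Ω : Type*} {mΩ : MeasurableSpace Ω} {P : Measure Ω} {F : Filtration ℝ≥0 mΩ}

/-- A partition is compatible with a simple process if it is cut by none of its times. -/
def SimpleProcess.Compatible (A : SimpleProcess F) (τ : ℕ → ℝ≥0) : Prop :=
  ∀ i ≤ A.n, ∀ j, A.time i < τ (j + 1) → A.time i ≤ τ j

/-- Cells and steps are both open on the left and closed on the right, so the value on a cell is the
one at its right end. -/
lemma SimpleProcess.Compatible.eval_eq {A : SimpleProcess F} {τ : ℕ → ℝ≥0} (h : A.Compatible τ)
    {j : ℕ} {u : ℝ≥0} (hu : u ∈ Set.Ioc (τ j) (τ (j + 1))) (ω : Ω) :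
    A.eval u ω = A.eval (τ (j + 1)) ω := by
  refine Finset.sum_congr rfl fun i hi ↦ ?_
  have hi' := Finset.mem_range.1 hi
  have h1 : A.time i < u ↔ A.time i < τ (j + 1) :=
    ⟨fun h' ↦ h'.trans_le hu.2, fun h' ↦ (h i hi'.le j h').trans_lt hu.1⟩
  have h2 : u ≤ A.time (i + 1) ↔ τ (j + 1) ≤ A.time (i + 1) := by
    refine ⟨fun h' ↦ ?_, fun h' ↦ hu.2.trans h'⟩
    by_contra hcon
    exact absurd (hu.1.trans_le h') (not_lt.2 (h (i + 1) hi' j (not_le.1 hcon)))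
  simp only [Set.indicator, Set.mem_Ioc, h1, h2]

/-- Although read off at the right end, the value is a coefficient fixed at a time not later than `τ
j`. -/
lemma SimpleProcess.Compatible.measurable_eval {A : SimpleProcess F} {τ : ℕ → ℝ≥0}
    (h : A.Compatible τ) (j : ℕ) : Measurable[F (τ j)] (A.eval (τ (j + 1))) := by
  refine Finset.measurable_fun_sum _ fun i hi ↦ ?_
  by_cases hmem : τ (j + 1) ∈ Set.Ioc (A.time i) (A.time (i + 1))
  · simp only [Set.indicator_of_mem hmem]
    exact (A.coef_meas i).mono (F.mono (h i (Finset.mem_range.1 hi).le j hmem.1)) le_rfl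
  · simp only [Set.indicator_of_notMem hmem]
    exact measurable_const

/-- As `b` is interior to no cell, each summand is an increment of `u ↦ f (min b u)`, and the sum
telescopes. It is applied to both ends of each step of a simple process. -/
lemma sum_ite_le_mul_sub {t : ℝ≥0} {h : ℝ} {τ : ℕ → ℝ≥0} {N : ℕ} (hτ : IsPartition t h τ N)
    {b : ℝ≥0} (hb : ∀ j, b < τ (j + 1) → b ≤ τ j) (f : ℝ≥0 → ℝ) :
    ∑ j ∈ Finset.range N, (if τ (j + 1) ≤ b then 1 else 0) * (f (τ (j + 1)) - f (τ j)) =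
      f (min b t) - f 0 := by
  have key j : (if τ (j + 1) ≤ b then 1 else 0) * (f (τ (j + 1)) - f (τ j)) =
      f (min b (τ (j + 1))) - f (min b (τ j)) := by
    split_ifs with hj
    · rw [min_eq_right hj, min_eq_right ((hτ.mono (Nat.le_succ j)).trans hj), one_mul]
    · have hj' := not_le.1 hj
      rw [min_eq_left hj'.le, min_eq_left (hb j hj')]
      simp
  simp_rw [key]
  rw [Finset.sum_range_sub (fun j ↦ f (min b (τ j))), hτ.last, hτ.zero]
  simp

lemma SimpleProcess.Compatible.integral_eq {A : SimpleProcess F} {t : ℝ≥0} {h : ℝ} {τ : ℕ → ℝ≥0}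
    {N : ℕ} (hA : A.Compatible τ) (hτ : IsPartition t h τ N) (B : ℝ≥0 → Ω → ℝ) (ω : Ω) :
    A.integral B t ω =
      ∑ j ∈ Finset.range N, A.eval (τ (j + 1)) ω * (B (τ (j + 1)) ω - B (τ j) ω) := by
  simp only [SimpleProcess.eval, Finset.sum_mul]
  rw [Finset.sum_comm]
  refine Finset.sum_congr rfl fun i hi ↦ ?_
  have hi' := Finset.mem_range.1 hi
  have e1 := sum_ite_le_mul_sub hτ (hA (i + 1) hi') (fun u ↦ B u ω)
  have e2 := sum_ite_le_mul_sub hτ (hA i hi'.le) (fun u ↦ B u ω)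
  have e3 : B (min (A.time (i + 1)) t) ω - B (min (A.time i) t) ω =
      ∑ j ∈ Finset.range N, ((if τ (j + 1) ≤ A.time (i + 1) then (1 : ℝ) else 0) -
        (if τ (j + 1) ≤ A.time i then 1 else 0)) * (B (τ (j + 1)) ω - B (τ j) ω) := by
    simp_rw [sub_mul]
    rw [Finset.sum_sub_distrib, e1, e2]
    ring
  rw [e3, Finset.mul_sum]
  refine Finset.sum_congr rfl fun j _ ↦ ?_
  have hm := A.time_mono (Nat.le_succ i)
  rw [← mul_assoc]
  congr 1
  by_cases h1 : τ (j + 1) ≤ A.time i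
  · have h2 : τ (j + 1) ≤ A.time (i + 1) := h1.trans hm
    have h3 : τ (j + 1) ∉ Set.Ioc (A.time i) (A.time (i + 1)) := fun h' ↦ absurd h'.1 (not_lt.2 h1)
    simp [h1, h2]
  · by_cases h2 : τ (j + 1) ≤ A.time (i + 1)
    · simp [h1, h2, Set.indicator, not_le.1 h1]
    · simp [h1, h2]

lemma IsPartition.sum_lintegral_Ioc {t : ℝ≥0} {h : ℝ} {τ : ℕ → ℝ≥0} {N : ℕ}
    (hτ : IsPartition t h τ N) (f : ℝ → ℝ≥0∞) :
    ∑ j ∈ Finset.range N, ∫⁻ u in Set.Ioc (τ j : ℝ) (τ (j + 1)), f u =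
      ∫⁻ u in Set.Ioc 0 (t : ℝ), f u := by
  have key (n : ℕ) : ∑ j ∈ Finset.range n, ∫⁻ u in Set.Ioc (τ j : ℝ) (τ (j + 1)), f u =
      ∫⁻ u in Set.Ioc 0 (τ n : ℝ), f u := by
    induction n with
    | zero => simp [hτ.zero]
    | succ n ih =>
      rw [Finset.sum_range_succ, ih, ← lintegral_union measurableSet_Ioc,
        Set.Ioc_union_Ioc_eq_Ioc (NNReal.coe_nonneg _)
          (NNReal.coe_le_coe.2 (hτ.mono (Nat.le_succ n)))]
      exact Set.Ioc_disjoint_Ioc_of_le le_rfl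
  rw [key, hτ.last]

/-- Replacing the integrand by its values at the left ends of a partition. -/
lemma SimpleProcess.Compatible.sum_sq_le {A : SimpleProcess F} {t : ℝ≥0} {h η : ℝ} {τ : ℕ → ℝ≥0}
    {N : ℕ} (hA : A.Compatible τ) (hτ : IsPartition t h τ N) (H : ℝ≥0 → Ω → ℝ) (ω : Ω)
    (hosc : ∀ u ≤ t, ∀ v ≤ t, dist u v ≤ h → |H u ω - H v ω| ≤ η) :
    ENNReal.ofReal (∑ j ∈ Finset.range N,
        (A.eval (τ (j + 1)) ω - H (τ j) ω) ^ 2 * ((τ (j + 1) : ℝ) - τ j)) ≤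
      2 * (∫⁻ u in Set.Icc 0 (t : ℝ),
        ENNReal.ofReal ((A.eval u.toNNReal ω - H u.toNNReal ω) ^ 2)) +
      ENNReal.ofReal (2 * η ^ 2 * t) := by
  have hΔ j : 0 ≤ (τ (j + 1) : ℝ) - τ j := sub_nonneg.2 (hτ.mono (Nat.le_succ j))
  rw [ENNReal.ofReal_sum_of_nonneg fun j _ ↦ mul_nonneg (sq_nonneg _) (hΔ j)]
  set f : ℝ → ℝ≥0∞ := fun u ↦ ENNReal.ofReal ((A.eval u.toNNReal ω - H u.toNNReal ω) ^ 2)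
  have hterm j : ENNReal.ofReal ((A.eval (τ (j + 1)) ω - H (τ j) ω) ^ 2 *
      ((τ (j + 1) : ℝ) - τ j)) ≤
      ∫⁻ u in Set.Ioc (τ j : ℝ) (τ (j + 1)), (2 * f u + ENNReal.ofReal (2 * η ^ 2)) := by
    rw [ENNReal.ofReal_mul (sq_nonneg _), ← Real.volume_Ioc, ← setLIntegral_const]
    refine setLIntegral_mono' measurableSet_Ioc fun u hu ↦ ?_
    have hu0 : 0 ≤ u := (NNReal.coe_nonneg _).trans hu.1.le
    lift u to ℝ≥0 using hu0
    have hu1 : u ∈ Set.Ioc (τ j) (τ (j + 1)) := by exact_mod_cast hu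
    simp only [f, Real.toNNReal_coe]
    rw [hA.eval_eq hu1 ω]
    have hut : u ≤ t := hu1.2.trans (hτ.le _)
    have hd : dist u (τ j) ≤ h := by
      rw [NNReal.dist_eq, abs_of_nonneg (sub_nonneg.2 hu.1.le)]
      linarith [hτ.mesh j, hu.2]
    have ho := hosc u hut (τ j) (hτ.le j) hd
    rw [show (2 : ℝ≥0∞) = ENNReal.ofReal 2 by simp, ← ENNReal.ofReal_mul zero_le_two,
      ← ENNReal.ofReal_add (by positivity) (by positivity)]
    refine ENNReal.ofReal_le_ofReal ?_
    have ho2 : (H u ω - H (τ j) ω) ^ 2 ≤ η ^ 2 := by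
      rw [← sq_abs]
      exact pow_le_pow_left₀ (abs_nonneg _) ho 2
    -- This is $(a+b)^2\le2a^2+2b^2$, the source of both factors 2.
    nlinarith [sq_nonneg ((A.eval (τ (j + 1)) ω - H u ω) - (H u ω - H (τ j) ω))]
  calc _ ≤ ∑ j ∈ Finset.range N,
        ∫⁻ u in Set.Ioc (τ j : ℝ) (τ (j + 1)), (2 * f u + ENNReal.ofReal (2 * η ^ 2)) :=
        Finset.sum_le_sum fun j _ ↦ hterm j
    _ = ∫⁻ u in Set.Ioc 0 (t : ℝ), (2 * f u + ENNReal.ofReal (2 * η ^ 2)) :=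
        hτ.sum_lintegral_Ioc _
    _ = 2 * (∫⁻ u in Set.Ioc 0 (t : ℝ), f u) + ENNReal.ofReal (2 * η ^ 2 * t) := by
        rw [lintegral_add_right _ measurable_const, lintegral_const_mul' _ _ (by simp),
          setLIntegral_const, Real.volume_Ioc, sub_zero, ← ENNReal.ofReal_mul (by positivity)]
    _ ≤ _ := by
        gcongr
        exact Set.Ioc_subset_Icc_self

end Partition

/-! ### Itô integrals as limits of left-point Riemann sums -/

section ItoLeftSums

variable {Ω : Type*} {mΩ : MeasurableSpace Ω} {P : Measure Ω} {F : Filtration ℝ≥0 mΩ}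

/-- For a process with continuous paths, the probability that the oscillation on scale `1 / (n + 1)`
exceeds `η` tends to zero. -/
lemma tendsto_measure_oscillation [IsProbabilityMeasure P] {H : ℝ≥0 → Ω → ℝ} {t : ℝ≥0}
    (hH : ∀ u ≤ t, Measurable (H u))
    (hcont : ∀ᵐ ω ∂P, ContinuousOn (fun u ↦ H u ω) (Set.Iic t)) {η : ℝ} (hη : 0 < η) :
    Tendsto (fun n : ℕ ↦ P {ω | ¬ ∀ u ≤ t, ∀ v ≤ t, dist u v ≤ 1 / ((n : ℝ) + 1) →
      |H u ω - H v ω| ≤ η}) atTop (𝓝 0) := by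
  have : Nonempty (Set.Iic t) := ⟨⟨t, Set.self_mem_Iic⟩⟩
  have hcpt : CompactSpace (Set.Iic t) := by
    rw [← isCompact_iff_compactSpace, ← Set.Icc_bot]
    exact isCompact_Icc
  set q := TopologicalSpace.denseSeq (Set.Iic t) with hq
  have hqd : DenseRange q := TopologicalSpace.denseRange_denseSeq _
  -- The oscillation is tested at countably many times for measurability. The strict bound `2 / (n +
  -- 1)` is looser than `1 / (n + 1)`, so a violating pair of times lies in an open set, which the
  -- dense sequence must meet.
  set G : ℕ → Set Ω := fun n ↦ {ω | ∃ i j, dist (q i) (q j) < 2 / ((n : ℝ) + 1) ∧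
    η < |H (q i) ω - H (q j) ω|} with hG
  have hGm n : MeasurableSet (G n) := by
    have : G n = ⋃ i, ⋃ j, ⋃ (_ : dist (q i) (q j) < 2 / ((n : ℝ) + 1)),
        {ω | η < |H (q i) ω - H (q j) ω|} := by
      ext ω; simp [hG]
    rw [this]
    refine MeasurableSet.iUnion fun i ↦ MeasurableSet.iUnion fun j ↦ MeasurableSet.iUnion fun _ ↦ ?_
    exact measurableSet_lt measurable_const ((hH _ (q i).2).sub (hH _ (q j).2)).abs
  have hanti : Antitone G := by
    rintro m n hmn ω ⟨i, j, hd, hlt⟩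
    refine ⟨i, j, hd.trans_le ?_, hlt⟩
    gcongr
  have hnull : P (⋂ n, G n) = 0 := by
    refine measure_mono_null (fun ω hω ↦ ?_) hcont
    simp only [Set.mem_compl_iff]
    intro hc
    have hc' : Continuous fun u : Set.Iic t ↦ H u ω := continuousOn_iff_continuous_domRestrict.1 hc
    obtain ⟨δ, hδ, hd⟩ := Metric.uniformContinuous_iff.1
      (CompactSpace.uniformContinuous_of_continuous hc') η hη
    obtain ⟨n, hn⟩ := exists_nat_gt (2 / δ)
    obtain ⟨i, j, hij, hlt⟩ := Set.mem_iInter.1 hω n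
    have hlt2 : 2 / ((n : ℝ) + 1) < δ := by
      rw [div_lt_iff₀ (by positivity)]
      rw [div_lt_iff₀ hδ] at hn
      nlinarith
    have := hd (hij.trans hlt2)
    rw [Real.dist_eq] at this
    exact absurd this (not_lt.2 hlt.le)
  have htend : Tendsto (fun n ↦ P (G n)) atTop (𝓝 0) := by
    have := tendsto_measure_iInter_atTop (μ := P) (fun n ↦ (hGm n).nullMeasurableSet) hanti
      ⟨0, measure_ne_top _ _⟩
    rwa [hnull] at this
  refine tendsto_of_tendsto_of_tendsto_of_le_of_le tendsto_const_nhds htend (fun n ↦ zero_le)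
    fun n ↦ ?_
  refine measure_mono_ae ?_
  filter_upwards [hcont] with ω hc hω
  by_contra hnot
  refine hω fun u hu v hv huv ↦ ?_
  by_contra hcon
  have hc' : Continuous fun u : Set.Iic t ↦ H u ω := continuousOn_iff_continuous_domRestrict.1 hc
  set O : Set (Set.Iic t × Set.Iic t) := {p | dist p.1 p.2 < 2 / ((n : ℝ) + 1) ∧
    η < |H p.1 ω - H p.2 ω|}
  have hO : IsOpen O := by
    have h1 : IsOpen {p : Set.Iic t × Set.Iic t | dist p.1 p.2 < 2 / ((n : ℝ) + 1)} :=
      isOpen_lt (by fun_prop) continuous_const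
    refine h1.and (isOpen_lt continuous_const ?_)
    exact ((hc'.comp continuous_fst).sub (hc'.comp continuous_snd)).abs
  have hne : O.Nonempty := by
    refine ⟨(⟨u, hu⟩, ⟨v, hv⟩), ?_, not_le.1 hcon⟩
    refine lt_of_le_of_lt huv ?_
    gcongr
    norm_num
  obtain ⟨⟨i, j⟩, hij⟩ := (hqd.prodMap hqd).exists_mem_open hO hne
  exact hnot ⟨i, j, hij.1, hij.2⟩

lemma tendstoInMeasure_add {f g : ℕ → Ω → ℝ} {a b : Ω → ℝ} (hf : TendstoInMeasure P f atTop a)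
    (hg : TendstoInMeasure P g atTop b) :
    TendstoInMeasure P (fun n ω ↦ f n ω + g n ω) atTop (fun ω ↦ a ω + b ω) := by
  rw [tendstoInMeasure_iff_dist] at hf hg ⊢
  intro ε hε
  have h := (hf (ε / 2) (half_pos hε)).add (hg (ε / 2) (half_pos hε))
  rw [add_zero] at h
  refine tendsto_of_tendsto_of_tendsto_of_le_of_le tendsto_const_nhds h (fun n ↦ zero_le)
    fun n ↦ ?_
  refine (measure_mono fun ω hω ↦ ?_).trans (measure_union_le _ _)
  by_contra hcon
  simp only [Set.mem_union, Set.mem_ofPred_eq, not_or, not_le] at hcon hω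
  have := dist_add_add_le (f n ω) (g n ω) (a ω) (b ω)
  linarith [hcon.1, hcon.2]

lemma tendstoInMeasure_const_mul {f : ℕ → Ω → ℝ} {a : Ω → ℝ} (hf : TendstoInMeasure P f atTop a)
    (c : ℝ) : TendstoInMeasure P (fun n ω ↦ c * f n ω) atTop (fun ω ↦ c * a ω) := by
  rw [tendstoInMeasure_iff_dist] at hf ⊢
  intro ε hε
  refine tendsto_of_tendsto_of_tendsto_of_le_of_le tendsto_const_nhds
    (hf (ε / (|c| + 1)) (by positivity)) (fun n ↦ zero_le) fun n ↦ measure_mono fun ω hω ↦ ?_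
  simp only [Set.mem_ofPred_eq, Real.dist_eq, ← mul_sub, abs_mul] at hω ⊢
  rw [div_le_iff₀ (by positivity)]
  nlinarith [abs_nonneg (f n ω - a ω)]

/-- The Itô integral of a process with continuous paths is a limit of left-point Riemann sums. -/
lemma IsItoIntegral.exists_tendsto_leftSum [IsProbabilityMeasure P] {B H : ℝ≥0 → Ω → ℝ} {t : ℝ≥0}
    {I : Ω → ℝ} (hB : IsBrownianWrt P F B) (hI : IsItoIntegral P F B H t I)
    (hcont : ∀ᵐ ω ∂P, ContinuousOn (fun u ↦ H u ω) (Set.Iic t)) :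
    ∃ (τ : ℕ → ℕ → ℝ≥0) (N : ℕ → ℕ), (∀ n : ℕ, IsPartition t (1 / ((n : ℝ) + 1)) (τ n) (N n)) ∧
      TendstoInMeasure P (fun n ω ↦ ∑ j ∈ Finset.range (N n),
        H (τ n j) ω * (B (τ n (j + 1)) ω - B (τ n j) ω)) atTop I := by
  classical
  obtain ⟨hHm, -, A, hA, hAI⟩ := hI
  have hex (n : ℕ) := exists_isPartition t ((Finset.range ((A n).n + 1)).image (A n).time)
    (h := 1 / ((n : ℝ) + 1)) (by positivity)
  choose τ N hτ hcomp using hex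
  have hcomp' n : (A n).Compatible (τ n) := fun i hi ↦
    hcomp n _ (Finset.mem_image.2 ⟨i, Finset.mem_range.2 (by lia), rfl⟩)
  refine ⟨τ, N, hτ, ?_⟩
  set c : ℕ → ℕ → Ω → ℝ := fun n j ω ↦ (A n).eval (τ n (j + 1)) ω - H (τ n j) ω
  have hcm n j : Measurable[F (τ n j)] (c n j) :=
    ((hcomp' n).measurable_eval j).sub (hHm _ ((hτ n).le j))
  have hdiff : TendstoInMeasure P (fun n ω ↦ ∑ j ∈ Finset.range (N n),
      c n j ω * (B (τ n (j + 1)) ω - B (τ n j) ω)) atTop (fun _ ↦ 0) := by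
    rw [tendstoInMeasure_iff_dist]
    intro ε hε
    simp only [dist_zero_right, Real.norm_eq_abs]
    rw [ENNReal.tendsto_nhds_zero]
    intro κ hκ
    obtain ⟨δ, hδ, hδκ⟩ : ∃ δ : ℝ, 0 < δ ∧ ENNReal.ofReal (δ / ε ^ 2) ≤ κ / 2 := by
      obtain ⟨r, hr0, hr⟩ := ENNReal.lt_iff_exists_nnreal_btwn.1 (ENNReal.half_pos hκ.ne')
      have hr0' : (0 : ℝ) < r := by exact_mod_cast hr0
      refine ⟨r * ε ^ 2, by positivity, ?_⟩
      rw [mul_div_assoc, div_self (by positivity), mul_one]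
      simpa using hr.le
    -- With this `η` the oscillation contributes `2 η² t < δ / 2` to the square sum, also at `t =
    -- 0`. Twice the approximation error, kept below `δ / 4`, contributes the other half.
    set η : ℝ := √(δ / (4 * (t + 1)))
    have hη : 0 < η := Real.sqrt_pos.2 (by positivity)
    have hη2 : 2 * η ^ 2 * t < δ / 2 + 0 := by
      rw [Real.sq_sqrt (by positivity), add_zero]
      have h2 : 2 * (δ / (4 * ((t : ℝ) + 1))) * t = δ / 2 * (t / (t + 1)) := by field_simp; ring
      rw [h2]
      have h3 : (t : ℝ) / (t + 1) < 1 := by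
        rw [div_lt_one (by positivity)]; linarith
      nlinarith
    have h1 := hA (ENNReal.ofReal (δ / 4)) (by simpa using hδ)
    have h2 := tendsto_measure_oscillation (P := P) (H := H) (t := t)
      (fun u hu ↦ (hHm u hu).mono (F.le _) le_rfl) hcont hη
    have h3 := h1.add h2
    rw [add_zero, ENNReal.tendsto_nhds_zero] at h3
    filter_upwards [h3 (κ / 2) (ENNReal.half_pos hκ.ne')] with n hn
    refine (hB.measure_abs_sum_ge_le (hτ n).mono (hcm n) (N n) hδ hε).trans ?_
    rw [← ENNReal.add_halves κ]
    refine add_le_add (le_trans ?_ hn) hδκ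
    refine (measure_mono fun ω hω ↦ ?_).trans (measure_union_le _ _)
    by_contra hcon
    simp only [Set.mem_union, Set.mem_ofPred_eq, not_or, not_le, not_not] at hcon hω
    have hle := (hcomp' n).sum_sq_le (hτ n) H ω hcon.2
    have hlt : 2 * (∫⁻ u in Set.Icc 0 (t : ℝ),
        ENNReal.ofReal (((A n).eval u.toNNReal ω - H u.toNNReal ω) ^ 2)) +
        ENNReal.ofReal (2 * η ^ 2 * t) < ENNReal.ofReal δ := by
      have e : ENNReal.ofReal δ = 2 * ENNReal.ofReal (δ / 4) + ENNReal.ofReal (δ / 2) := by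
        rw [show (2 : ℝ≥0∞) = ENNReal.ofReal 2 by simp, ← ENNReal.ofReal_mul zero_le_two,
          ← ENNReal.ofReal_add (by positivity) (by positivity)]
        congr 1; ring
      rw [e]
      refine ENNReal.add_lt_add ?_ ?_
      · exact (ENNReal.mul_lt_mul_iff_right (by simp) (by simp)).2 hcon.1
      · rw [add_zero] at hη2
        exact (ENNReal.ofReal_lt_ofReal_iff (by positivity)).2 hη2
    exact absurd (ENNReal.ofReal_le_ofReal hω) (not_le.2 (hle.trans_lt hlt))
  have hsum := tendstoInMeasure_add hAI (tendstoInMeasure_const_mul hdiff (-1))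
  refine hsum.congr (fun n ↦ ae_of_all _ fun ω ↦ ?_) (ae_of_all _ fun ω ↦ by simp)
  simp only
  rw [(hcomp' n).integral_eq (hτ n), neg_one_mul, ← sub_eq_add_neg, ← Finset.sum_sub_distrib]
  exact Finset.sum_congr rfl fun j _ ↦ by simp only [c]; ring

end ItoLeftSums

/-! ### The exponential martingale solves its equation -/

section GeometricBrownian

lemma integral_exp_mul_gaussianReal (a : ℝ) (v : ℝ≥0) :
    ∫ x, Real.exp (a * x) ∂gaussianReal 0 v = Real.exp (v * a ^ 2 / 2) := by
  have h := congrFun (mgf_fun_id_gaussianReal (μ := 0) (v := v)) a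
  simpa [mgf] using h

lemma integral_mul_exp_mul_gaussianReal (a : ℝ) (v : ℝ≥0) :
    ∫ x, x * Real.exp (a * x) ∂gaussianReal 0 v = v * a * Real.exp (v * a ^ 2 / 2) := by
  have h := deriv_mgf (X := fun x : ℝ ↦ x) (μ := gaussianReal 0 v) (t := a) (by simp)
  rw [mgf_fun_id_gaussianReal] at h
  rw [← h]
  have h1 : HasDerivAt (fun t : ℝ ↦ Real.exp (0 * t + v * t ^ 2 / 2))
      (Real.exp (0 * a + v * a ^ 2 / 2) * (0 * 1 + v * (2 * a) / 2)) a := by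
    refine HasDerivAt.exp ?_
    refine ((hasDerivAt_id a).const_mul 0).add ?_
    have := ((hasDerivAt_pow 2 a).const_mul (v : ℝ)).div_const 2
    simpa using this
  rw [h1.deriv]
  simp only [zero_mul, zero_add]
  ring

lemma integrable_mul_exp_mul_gaussianReal (a : ℝ) (v : ℝ≥0) :
    Integrable (fun x ↦ x * Real.exp (a * x)) (gaussianReal 0 v) := by
  have := integrable_pow_mul_exp_of_integrable_exp_mul (X := fun x : ℝ ↦ x) (v := a)
    (μ := gaussianReal 0 v) one_ne_zero (integrable_exp_mul_gaussianReal _)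
    (integrable_exp_mul_gaussianReal _) 1
  simpa using this

/-- The remainder `e^{σx - σ²v/2} - 1 - σx` of the first order expansion of an exponential
martingale. -/
noncomputable def expRemainder (σ : ℝ) (v : ℝ≥0) (x : ℝ) : ℝ :=
  Real.exp (σ * x - σ ^ 2 * v / 2) - 1 - σ * x

lemma expRemainder_eq (σ : ℝ) (v : ℝ≥0) (x : ℝ) :
    expRemainder σ v x = Real.exp (-(σ ^ 2 * v / 2)) * Real.exp (σ * x) - 1 - σ * x := by
  rw [expRemainder, ← Real.exp_add]
  congr 3; ring

lemma expRemainder_sq (σ : ℝ) (v : ℝ≥0) (x : ℝ) :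
    expRemainder σ v x ^ 2 = Real.exp (-(σ ^ 2 * v / 2)) ^ 2 * Real.exp (2 * σ * x)
      - 2 * Real.exp (-(σ ^ 2 * v / 2)) * Real.exp (σ * x)
      - 2 * σ * Real.exp (-(σ ^ 2 * v / 2)) * (x * Real.exp (σ * x))
      + (1 + 2 * σ * x + σ ^ 2 * x ^ 2) := by
  have : Real.exp (2 * σ * x) = Real.exp (σ * x) ^ 2 := by 
    rw [← Real.exp_nat_mul]; congr 1; push_cast; ring
  rw [expRemainder_eq, this]
  ring

lemma measurable_expRemainder (σ : ℝ) (v : ℝ≥0) : Measurable (expRemainder σ v) := by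
  unfold expRemainder
  fun_prop

lemma integrable_id_gaussianReal (v : ℝ≥0) : Integrable (fun x ↦ x) (gaussianReal 0 v) :=
  (memLp_id_gaussianReal' 1 (by simp)).integrable le_rfl

lemma integrable_sq_gaussianReal (v : ℝ≥0) : Integrable (fun x ↦ x ^ 2) (gaussianReal 0 v) :=
  (memLp_id_gaussianReal' 2 (by simp)).integrable_sq

lemma integral_sq_gaussianReal (v : ℝ≥0) : ∫ x, x ^ 2 ∂gaussianReal 0 v = v := by
  have h := variance_eq_sub (memLp_id_gaussianReal' (μ := 0) (v := v) 2 (by simp))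
  rw [variance_id_gaussianReal] at h
  simpa using h.symm

lemma integrable_quadratic_gaussianReal (σ : ℝ) (v : ℝ≥0) :
    Integrable (fun x ↦ 1 + 2 * σ * x + σ ^ 2 * x ^ 2) (gaussianReal 0 v) :=
  ((integrable_const _).add ((integrable_id_gaussianReal v).const_mul _)).add
    ((integrable_sq_gaussianReal v).const_mul _)

/-- The exponential has mean one and `x` mean zero, so remainders along a partition are martingale
increments and the orthogonality argument applies to them. -/
lemma integral_expRemainder (σ : ℝ) (v : ℝ≥0) : ∫ x, expRemainder σ v x ∂gaussianReal 0 v = 0 := by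
  simp_rw [expRemainder_eq]
  have h1 : Integrable (fun x ↦ Real.exp (-(σ ^ 2 * v / 2)) * Real.exp (σ * x))
    (gaussianReal 0 v) := (integrable_exp_mul_gaussianReal _).const_mul _
  have h2 : Integrable (fun x ↦ Real.exp (-(σ ^ 2 * v / 2)) * Real.exp (σ * x) - 1)
    (gaussianReal 0 v) := h1.sub (integrable_const _)
  rw [integral_sub h2 ((integrable_id_gaussianReal v).const_mul _),
    integral_sub h1 (integrable_const _), integral_const_mul, integral_const_mul,
    integral_exp_mul_gaussianReal, integral_id_gaussianReal, ← Real.exp_add]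
  have : -(σ ^ 2 * (v : ℝ) / 2) + v * σ ^ 2 / 2 = 0 := by ring
  simp [this]

/-- The second moment is of order $v^2$, so its sum over a partition is of the order of the mesh. -/
lemma integral_expRemainder_sq (σ : ℝ) (v : ℝ≥0) :
    Integrable (fun x ↦ expRemainder σ v x ^ 2) (gaussianReal 0 v) ∧
    ∫ x, expRemainder σ v x ^ 2 ∂gaussianReal 0 v = Real.exp (σ ^ 2 * v) - 1 - σ ^ 2 * v := by
  simp_rw [expRemainder_sq]
  have h1 : Integrable (fun x ↦ Real.exp (-(σ ^ 2 * v / 2)) ^ 2 * Real.exp (2 * σ * x))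
    (gaussianReal 0 v) := (integrable_exp_mul_gaussianReal _).const_mul _
  have h2 : Integrable (fun x ↦ 2 * Real.exp (-(σ ^ 2 * v / 2)) * Real.exp (σ * x))
    (gaussianReal 0 v) := (integrable_exp_mul_gaussianReal _).const_mul _
  have h3 : Integrable (fun x ↦ 2 * σ * Real.exp (-(σ ^ 2 * v / 2)) * (x * Real.exp (σ * x)))
    (gaussianReal 0 v) := (integrable_mul_exp_mul_gaussianReal _ _).const_mul _
  have h4 := integrable_quadratic_gaussianReal σ v
  have h12 : Integrable (fun x ↦ Real.exp (-(σ ^ 2 * v / 2)) ^ 2 * Real.exp (2 * σ * x) -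
    2 * Real.exp (-(σ ^ 2 * v / 2)) * Real.exp (σ * x)) (gaussianReal 0 v) := h1.sub h2
  have h123 : Integrable (fun x ↦ Real.exp (-(σ ^ 2 * v / 2)) ^ 2 * Real.exp (2 * σ * x) -
    2 * Real.exp (-(σ ^ 2 * v / 2)) * Real.exp (σ * x) -
    2 * σ * Real.exp (-(σ ^ 2 * v / 2)) * (x * Real.exp (σ * x))) (gaussianReal 0 v) := h12.sub h3
  refine ⟨h123.add h4, ?_⟩
  have h4' : ∫ x, (1 + 2 * σ * x + σ ^ 2 * x ^ 2) ∂gaussianReal 0 v = 1 + σ ^ 2 * v := by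
    have ha : Integrable (fun x : ℝ ↦ 1 + 2 * σ * x) (gaussianReal 0 v) :=
      (integrable_const _).add ((integrable_id_gaussianReal v).const_mul _)
    rw [integral_add ha ((integrable_sq_gaussianReal v).const_mul _),
      integral_add (integrable_const _) ((integrable_id_gaussianReal v).const_mul _),
      integral_const_mul, integral_const_mul, integral_id_gaussianReal, integral_sq_gaussianReal]
    simp
  rw [integral_add h123 h4, integral_sub h12 h3, integral_sub h1 h2, integral_const_mul,
    integral_const_mul, integral_const_mul, integral_exp_mul_gaussianReal,
    integral_exp_mul_gaussianReal, integral_mul_exp_mul_gaussianReal, h4']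
  have e1 : Real.exp (-(σ ^ 2 * v / 2)) ^ 2 * Real.exp (v * (2 * σ) ^ 2 / 2) =
      Real.exp (σ ^ 2 * v) := by
    rw [← Real.exp_nat_mul, ← Real.exp_add]; congr 1; push_cast; ring
  have e2 : Real.exp (-(σ ^ 2 * v / 2)) * Real.exp (v * σ ^ 2 / 2) = 1 := by
    rw [← Real.exp_add, Real.exp_eq_one_iff]; ring
  rw [e1]
  linear_combination (-2 - 2 * σ ^ 2 * v) * e2

lemma exp_sub_one_sub_le {x : ℝ} (hx : 0 ≤ x) :
    Real.exp x - 1 - x ≤ x ^ 2 * Real.exp x := by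
  have h1 : Real.exp x - 1 ≤ x * Real.exp x := by
    have := Real.add_one_le_exp (-x)
    have h2 : Real.exp (-x) * Real.exp x = 1 := by rw [← Real.exp_add]; simp
    nlinarith [Real.exp_pos x]
  nlinarith

variable {Ω : Type*} {mΩ : MeasurableSpace Ω} {P : Measure Ω} {F : Filtration ℝ≥0 mΩ}
  {B : ℝ≥0 → Ω → ℝ}

/-- The exponential martingale `e^{σB_u - σ²u/2}`. -/
noncomputable def expMartingale (σ : ℝ) (B : ℝ≥0 → Ω → ℝ) (u : ℝ≥0) (ω : Ω) : ℝ :=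
  Real.exp (σ * B u ω - σ ^ 2 * u / 2)

lemma IsBrownianWrt.hasLaw_eval (hB : IsBrownianWrt P F B) (u : ℝ≥0) :
    HasLaw (B u) (gaussianReal 0 u) P := by
  have h := hB.hasLaw 0 u zero_le
  rw [tsub_zero] at h
  refine h.congr ?_
  filter_upwards [hB.zero] with ω hω
  simp [hω]

lemma IsBrownianWrt.integral_expMartingale_sq (hB : IsBrownianWrt P F B) (σ : ℝ) (u : ℝ≥0) :
    MemLp (expMartingale σ B u) 2 P ∧
      ∫ ω, expMartingale σ B u ω ^ 2 ∂P = Real.exp (σ ^ 2 * u) := by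
  have hlaw := hB.hasLaw_eval u
  have e ω : expMartingale σ B u ω ^ 2 =
      Real.exp (-(σ ^ 2 * u)) * Real.exp (2 * σ * B u ω) := by
    rw [expMartingale, ← Real.exp_nat_mul, ← Real.exp_add]; congr 1; push_cast; ring
  have hi : Integrable (fun ω ↦ Real.exp (2 * σ * B u ω)) P := by
    have h := integrable_exp_mul_gaussianReal (μ := 0) (v := u) (2 * σ)
    rw [← hlaw.map_eq, integrable_map_measure (by fun_prop) hlaw.aemeasurable] at h
    exact h
  refine ⟨?_, ?_⟩
  · have hm : Measurable (B u) := (hB.measurable u).mono (F.le _) le_rfl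
    have hm' : Measurable (expMartingale σ B u) := by unfold expMartingale; fun_prop
    rw [memLp_two_iff_integrable_sq hm'.aestronglyMeasurable]
    simp_rw [e]
    exact hi.const_mul _
  · simp_rw [e]
    rw [integral_const_mul]
    have h := hlaw.integral_comp (f := fun x ↦ Real.exp (2 * σ * x)) (by fun_prop)
    rw [Function.comp_def] at h
    rw [h, integral_exp_mul_gaussianReal, ← Real.exp_add]
    congr 1; ring

/-- The increments of the martingale are multiplicative, so after telescoping the error is exactly a
sum of remainders. -/
lemma IsBrownianWrt.expMartingale_sub_sum [IsProbabilityMeasure P] (hB : IsBrownianWrt P F B)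
    (σ : ℝ) {t : ℝ≥0} {h : ℝ} {τ : ℕ → ℝ≥0} {N : ℕ} (hτ : IsPartition t h τ N) :
    ∀ᵐ ω ∂P, expMartingale σ B t ω - 1 - ∑ j ∈ Finset.range N,
        σ * expMartingale σ B (τ j) ω * (B (τ (j + 1)) ω - B (τ j) ω) =
      ∑ j ∈ Finset.range N, expMartingale σ B (τ j) ω *
        expRemainder σ (τ (j + 1) - τ j) (B (τ (j + 1)) ω - B (τ j) ω) := by
  filter_upwards [hB.zero] with ω hω
  have h0 : expMartingale σ B (τ 0) ω = 1 := by simp [expMartingale, hτ.zero, hω]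
  rw [← hτ.last, ← h0, ← Finset.sum_range_sub (fun j ↦ expMartingale σ B (τ j) ω),
    ← Finset.sum_sub_distrib]
  refine Finset.sum_congr rfl fun j _ ↦ ?_
  have e : expMartingale σ B (τ (j + 1)) ω = expMartingale σ B (τ j) ω *
      Real.exp (σ * (B (τ (j + 1)) ω - B (τ j) ω) -
        σ ^ 2 * ((τ (j + 1) - τ j : ℝ≥0) : ℝ) / 2) := by
    rw [expMartingale, expMartingale, ← Real.exp_add, NNReal.coe_sub (hτ.mono (Nat.le_succ j))]
    congr 1; ring
  rw [e, expRemainder]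
  ring

lemma IsPartition.sum_sub {t : ℝ≥0} {h : ℝ} {τ : ℕ → ℝ≥0} {N : ℕ} (hτ : IsPartition t h τ N) :
    ∑ j ∈ Finset.range N, ((τ (j + 1) : ℝ) - τ j) = t := by
  rw [Finset.sum_range_sub (fun j ↦ (τ j : ℝ)), hτ.last, hτ.zero]
  simp

/-- The exponential martingale solves its stochastic differential equation, up to an error in mean
square which is of the order of the mesh. -/
lemma IsBrownianWrt.integral_sq_sum_expRemainder_le [IsProbabilityMeasure P]
    (hB : IsBrownianWrt P F B) (σ : ℝ) {t : ℝ≥0} {h : ℝ} {τ : ℕ → ℝ≥0} {N : ℕ}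
    (hτ : IsPartition t h τ N) :
    MemLp (fun ω ↦ ∑ j ∈ Finset.range N, expMartingale σ B (τ j) ω *
        expRemainder σ (τ (j + 1) - τ j) (B (τ (j + 1)) ω - B (τ j) ω)) 2 P ∧
      ∫ ω, (∑ j ∈ Finset.range N, expMartingale σ B (τ j) ω *
        expRemainder σ (τ (j + 1) - τ j) (B (τ (j + 1)) ω - B (τ j) ω)) ^ 2 ∂P ≤
      Real.exp (σ ^ 2 * t) * (σ ^ 4 * Real.exp (σ ^ 2 * t) * t) * h := by
  have hle j : τ j ≤ τ (j + 1) := hτ.mono (Nat.le_succ j)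
  have hlaw j := hB.hasLaw _ _ (hle j)
  have hm j : Measurable[F (τ (j + 1))] fun ω ↦ B (τ (j + 1)) ω - B (τ j) ω :=
    (hB.measurable _).sub ((hB.measurable (τ j)).mono (F.mono (hle j)) le_rfl)
  have hξm j : Measurable[F (τ (j + 1))] fun ω ↦
      expRemainder σ (τ (j + 1) - τ j) (B (τ (j + 1)) ω - B (τ j) ω) :=
    (measurable_expRemainder _ _).comp (hm j)
  have hint j := (integral_expRemainder_sq σ (τ (j + 1) - τ j)).1
  obtain ⟨h1, h2⟩ := integral_sq_sum_mul (P := P) (F := F) hτ.mono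
    (c := fun j ↦ expMartingale σ B (τ j))
    (ξ := fun j ω ↦ expRemainder σ (τ (j + 1) - τ j) (B (τ (j + 1)) ω - B (τ j) ω))
    (v := fun j ↦ Real.exp (σ ^ 2 * ((τ (j + 1) - τ j : ℝ≥0) : ℝ)) - 1 -
      σ ^ 2 * ((τ (j + 1) - τ j : ℝ≥0) : ℝ))
    (fun j ↦ by
      have := hB.measurable (τ j)
      exact (((this.const_mul σ).sub_const _)).exp)
    (fun j ↦ (hB.integral_expMartingale_sq σ _).1) hξm
    (fun j ↦ by
      rw [memLp_two_iff_integrable_sq ((hξm j).mono (F.le _) le_rfl).aestronglyMeasurable]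
      have h := hint j
      rw [← (hlaw j).map_eq, integrable_map_measure
        ((measurable_expRemainder _ _).pow_const 2).aestronglyMeasurable (hlaw j).aemeasurable] at h
      exact h)
    (fun j ↦ by
      have h := (hlaw j).integral_comp (f := expRemainder σ (τ (j + 1) - τ j))
        (measurable_expRemainder _ _).aestronglyMeasurable
      rw [integral_expRemainder] at h
      exact h)
    (fun j ↦ by
      have h := (hlaw j).integral_comp (f := fun x ↦ expRemainder σ (τ (j + 1) - τ j) x ^ 2)
        ((measurable_expRemainder _ _).pow_const 2).aestronglyMeasurable
      rw [(integral_expRemainder_sq _ _).2] at h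
      exact h)
    (fun j ↦ by
      refine indep_of_indep_of_le_left (hB.indep _ _ (hle j)) ?_
      refine Measurable.comap_le ?_
      exact (measurable_expRemainder _ _).comp (comap_measurable _)) N
  refine ⟨h1, h2.trans_le ?_⟩
  have hterm j : (∫ ω, expMartingale σ B (τ j) ω ^ 2 ∂P) *
      (Real.exp (σ ^ 2 * ((τ (j + 1) - τ j : ℝ≥0) : ℝ)) - 1 -
        σ ^ 2 * ((τ (j + 1) - τ j : ℝ≥0) : ℝ)) ≤
      Real.exp (σ ^ 2 * t) * (σ ^ 4 * Real.exp (σ ^ 2 * t) * h) * ((τ (j + 1) : ℝ) - τ j) := by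
    rw [(hB.integral_expMartingale_sq σ _).2, NNReal.coe_sub (hle j)]
    have hΔ : 0 ≤ (τ (j + 1) : ℝ) - τ j := sub_nonneg.2 (hle j)
    have hΔh := hτ.mesh j
    have hΔt : (τ (j + 1) : ℝ) - τ j ≤ t := by
      have : (τ (j + 1) : ℝ) ≤ t := hτ.le _
      linarith [NNReal.coe_nonneg (τ j)]
    set Δ := (τ (j + 1) : ℝ) - τ j
    have hjt : (τ j : ℝ) ≤ t := hτ.le j
    have hb := exp_sub_one_sub_le (x := σ ^ 2 * Δ) (by positivity)
    have hnn : 0 ≤ Real.exp (σ ^ 2 * Δ) - 1 - σ ^ 2 * Δ := by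
      linarith [Real.add_one_le_exp (σ ^ 2 * Δ)]
    rw [mul_assoc (Real.exp (σ ^ 2 * t))]
    refine mul_le_mul ?_ (hb.trans ?_) hnn (Real.exp_pos _).le
    · gcongr
    -- One factor `Δ` is bounded by the mesh; the other is kept and sums to `t`.
    · calc (σ ^ 2 * Δ) ^ 2 * Real.exp (σ ^ 2 * Δ) = σ ^ 4 * Real.exp (σ ^ 2 * Δ) * Δ * Δ := by ring
        _ ≤ σ ^ 4 * Real.exp (σ ^ 2 * t) * h * Δ := by gcongr
  refine (Finset.sum_le_sum fun j _ ↦ hterm j).trans ?_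
  rw [← Finset.mul_sum, hτ.sum_sub]
  exact le_of_eq (by ring)

/-- The partitions must be arbitrary here, since they will be dictated by the Itô integral of `S`.
-/
lemma IsBrownianWrt.tendsto_leftSum_expMartingale [IsProbabilityMeasure P]
    (hB : IsBrownianWrt P F B) (σ : ℝ) {t : ℝ≥0} {τ : ℕ → ℕ → ℝ≥0} {N : ℕ → ℕ}
    (hτ : ∀ n : ℕ, IsPartition t (1 / ((n : ℝ) + 1)) (τ n) (N n)) :
    TendstoInMeasure P (fun n ω ↦ ∑ j ∈ Finset.range (N n),
      σ * expMartingale σ B (τ n j) ω * (B (τ n (j + 1)) ω - B (τ n j) ω)) atTop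
      (fun ω ↦ expMartingale σ B t ω - 1) := by
  rw [tendstoInMeasure_iff_dist]
  intro ε hε
  set C := Real.exp (σ ^ 2 * t) * (σ ^ 4 * Real.exp (σ ^ 2 * t) * t)
  have hlim : Tendsto (fun n : ℕ ↦ ENNReal.ofReal (C * (1 / ((n : ℝ) + 1)) / ε ^ 2)) atTop
      (𝓝 0) := by
    have h := (tendsto_one_div_add_atTop_nhds_zero_nat (𝕜 := ℝ)).const_mul C
    have h2 := (h.div_const (ε ^ 2))
    simpa using ENNReal.tendsto_ofReal h2
  refine tendsto_of_tendsto_of_tendsto_of_le_of_le tendsto_const_nhds hlim (fun n ↦ zero_le)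
    fun n ↦ ?_
  obtain ⟨h1, h2⟩ := hB.integral_sq_sum_expRemainder_le σ (hτ n)
  refine le_trans (measure_mono_ae ?_) (measure_abs_ge_le_of_integral_sq_le h1 hε h2)
  filter_upwards [hB.expMartingale_sub_sum σ (hτ n)] with ω hω hmem
  change ε ≤ |_|
  rw [← hω, abs_sub_comm]
  exact hmem

end GeometricBrownian

/-! ### Uniqueness for the linear equation -/

section Uniqueness

variable {Ω : Type*} {mΩ : MeasurableSpace Ω} {P : Measure Ω} {F : Filtration ℝ≥0 mΩ}
  {B D : ℝ≥0 → Ω → ℝ}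

/-- A left-point bound for $\int_a^b(n+1)x^n\,dx$, the integrand being increasing. -/
lemma pow_succ_add_mul_sub_le {a b : ℝ} (ha : 0 ≤ a) (hab : a ≤ b) (n : ℕ) :
    ((n : ℝ) + 1) * (a ^ n * (b - a)) ≤ b ^ (n + 1) - a ^ (n + 1) := by
  induction n with
  | zero => simp
  | succ n ih =>
    have hb : 0 ≤ b := ha.trans hab
    have h1 := mul_le_mul_of_nonneg_left ih hb
    have h2 : 0 ≤ ((n : ℝ) + 1) * (a ^ n * (b - a)) * (b - a) := by
      have := sub_nonneg.2 hab
      positivity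
    push_cast
    have e : b ^ (n + 1 + 1) - a ^ (n + 1 + 1) - ((n : ℝ) + 1 + 1) * (a ^ (n + 1) * (b - a)) =
        (b * (b ^ (n + 1) - a ^ (n + 1)) - b * (((n : ℝ) + 1) * (a ^ n * (b - a)))) +
          ((n : ℝ) + 1) * (a ^ n * (b - a)) * (b - a) := by ring
    linarith

lemma IsPartition.sum_pow_mul_sub_le {t : ℝ≥0} {h : ℝ} {τ : ℕ → ℝ≥0} {N : ℕ}
    (hτ : IsPartition t h τ N) (n : ℕ) :
    ∑ j ∈ Finset.range N, (τ j : ℝ) ^ n * ((τ (j + 1) : ℝ) - τ j) ≤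
      (t : ℝ) ^ (n + 1) / (n + 1) := by
  rw [le_div_iff₀ (by positivity), mul_comm, Finset.mul_sum]
  calc _ ≤ ∑ j ∈ Finset.range N, ((τ (j + 1) : ℝ) ^ (n + 1) - (τ j : ℝ) ^ (n + 1)) :=
        Finset.sum_le_sum fun j _ ↦ pow_succ_add_mul_sub_le (NNReal.coe_nonneg _)
          (NNReal.coe_le_coe.2 (hτ.mono (Nat.le_succ j))) n
    _ = (t : ℝ) ^ (n + 1) := by
        rw [Finset.sum_range_sub (fun j ↦ (τ j : ℝ) ^ (n + 1)), hτ.last, hτ.zero]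
        simp

lemma eLpNorm_two_eq_ofReal_sqrt {X : Ω → ℝ} (hX : MemLp X 2 P) :
    eLpNorm X 2 P = ENNReal.ofReal (√(∫ ω, X ω ^ 2 ∂P)) := by
  rw [hX.eLpNorm_eq_integral_rpow_norm two_ne_zero (by simp)]
  simp [Real.sqrt_eq_rpow]

/-- The event that `|D|` stays below `K` up to time `u`, tested on a countable set of times. -/
def boundedUpTo (D : ℝ≥0 → Ω → ℝ) (K : ℝ) (u : ℝ≥0) : Set Ω :=
  {ω | |D u ω| ≤ K ∧ ∀ n, |D (min (TopologicalSpace.denseSeq ℝ≥0 n) u) ω| ≤ K}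

lemma measurableSet_boundedUpTo {T : ℝ≥0} (hD : ∀ u ≤ T, Measurable[F u] (D u)) (K : ℝ) {u : ℝ≥0}
    (hu : u ≤ T) : MeasurableSet[F u] (boundedUpTo D K u) := by
  have h1 : MeasurableSet[F u] {ω | |D u ω| ≤ K} :=
    measurableSet_le (continuous_abs.measurable.comp (hD u hu)) measurable_const
  have h2 n : MeasurableSet[F u] {ω | |D (min (TopologicalSpace.denseSeq ℝ≥0 n) u) ω| ≤ K} :=
    measurableSet_le (continuous_abs.measurable.comp ((hD _ ((min_le_right _ _).trans hu)).mono
      (F.mono (min_le_right _ _)) le_rfl)) measurable_const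
  have : boundedUpTo D K u = {ω | |D u ω| ≤ K} ∩
      ⋂ n, {ω | |D (min (TopologicalSpace.denseSeq ℝ≥0 n) u) ω| ≤ K} := by
    ext ω; simp [boundedUpTo]
  rw [this]
  exact h1.inter (MeasurableSet.iInter h2)

/-- Continuity lets the countable test, chosen for measurability, control all times up to `u`. On
continuous paths the events therefore decrease in `u`. -/
lemma mem_boundedUpTo_iff {T u : ℝ≥0} {K : ℝ} {ω : Ω}
    (hc : ContinuousOn (fun u ↦ D u ω) (Set.Iic T)) (hu : u ≤ T) :
    ω ∈ boundedUpTo D K u ↔ ∀ v ≤ u, |D v ω| ≤ K := by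
  refine ⟨fun h v hv ↦ ?_, fun h ↦ ⟨h u le_rfl, fun n ↦ h _ (min_le_right _ _)⟩⟩
  have hc' : Continuous fun v ↦ |D (min v u) ω| :=
    (hc.comp_continuous (f := fun v ↦ min v u) (by fun_prop)
      (fun v ↦ (min_le_right _ _).trans hu)).abs
  have hclosed : IsClosed {v | |D (min v u) ω| ≤ K} := isClosed_le hc' continuous_const
  have hall : ∀ v, |D (min v u) ω| ≤ K := fun v ↦
    (TopologicalSpace.denseRange_denseSeq ℝ≥0).induction_on (p := fun v ↦ |D (min v u) ω| ≤ K)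
      v hclosed h.2
  simpa [min_eq_left hv] using hall v

/-- A continuous adapted solution of `dD = σ D dB`, `D_0 = 0`, understood as a limit of left-point
Riemann sums, vanishes. -/
lemma IsBrownianWrt.ae_eq_zero_of_tendsto_leftSum [IsProbabilityMeasure P]
    (hB : IsBrownianWrt P F B) {σ : ℝ} {T : ℝ≥0} (hD : ∀ u ≤ T, Measurable[F u] (D u))
    (hc : ∀ᵐ ω ∂P, ContinuousOn (fun u ↦ D u ω) (Set.Iic T))
    (heq : ∀ t ≤ T, ∃ (τ : ℕ → ℕ → ℝ≥0) (N : ℕ → ℕ),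
      (∀ n : ℕ, IsPartition t (1 / ((n : ℝ) + 1)) (τ n) (N n)) ∧
      TendstoInMeasure P (fun n ω ↦ ∑ j ∈ Finset.range (N n),
        σ * D (τ n j) ω * (B (τ n (j + 1)) ω - B (τ n j) ω)) atTop (D t))
    {t : ℝ≥0} (ht : t ≤ T) : ∀ᵐ ω ∂P, D t ω = 0 := by
  classical
  -- Truncation supplies the square integrability that `D` may lack and keeps the process adapted.
  set X : ℕ → ℝ≥0 → Ω → ℝ := fun K u ↦ (boundedUpTo D K u).indicator (D u) with hX
  have hXm K u (hu : u ≤ T) : Measurable[F u] (X K u) :=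
    (hD u hu).indicator (measurableSet_boundedUpTo hD K hu)
  have hXb K u ω : |X K u ω| ≤ K := by
    simp only [hX, Set.indicator]
    split_ifs with h
    · exact h.1
    · simp
  have hX2 K u (hu : u ≤ T) : MemLp (X K u) 2 P :=
    MemLp.of_bound ((hXm K u hu).mono (F.le _) le_rfl).aestronglyMeasurable (K : ℝ)
      (ae_of_all _ fun ω ↦ hXb K u ω)
  -- Iteration of $E X_u^2\le\sigma^2\int_0^uE X_r^2\,dr$ from the crude bound `K ^ 2`, with
  -- left-point sums in place of the integral.
  have hbound (K n : ℕ) : ∀ u ≤ T, ∫ ω, X K u ω ^ 2 ∂P ≤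
      (K : ℝ) ^ 2 * ((σ ^ 2 * u) ^ n / n.factorial) := by
    induction n with
    | zero =>
      intro u hu
      calc _ ≤ ∫ _, (K : ℝ) ^ 2 ∂P := by
            refine integral_mono (hX2 K u hu).integrable_sq (integrable_const _) fun ω ↦ ?_
            simp only
            rw [← sq_abs]
            exact pow_le_pow_left₀ (abs_nonneg _) (hXb K u ω) 2
        _ = _ := by simp
    | succ n ih =>
      intro u hu
      obtain ⟨τ, N, hτ, hlim⟩ := heq u hu
      set C : ℝ := (K : ℝ) ^ 2 * ((σ ^ 2 * u) ^ (n + 1) / (n + 1).factorial)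
      have hC : 0 ≤ C := by positivity
      have hAm : MeasurableSet (boundedUpTo D K u) := F.le _ _ (measurableSet_boundedUpTo hD K hu)
      have hlim' := hlim.indicator (boundedUpTo D K u)
      set Y : ℕ → Ω → ℝ := fun m ω ↦ ∑ j ∈ Finset.range (N m),
        (σ * X K (τ m j) ω) * (B (τ m (j + 1)) ω - B (τ m j) ω) with hY
      have hYI m := hB.integral_sq_sum (hτ m).mono (c := fun j ω ↦ σ * X K (τ m j) ω)
        (fun j ↦ (hXm K _ (((hτ m).le j).trans hu)).const_mul σ)
        (fun j ↦ (hX2 K _ (((hτ m).le j).trans hu)).const_mul σ) (N m)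
      have hYC m : ∫ ω, Y m ω ^ 2 ∂P ≤ C := by
        rw [(hYI m).2]
        have hterm j : (∫ ω, (σ * X K (τ m j) ω) ^ 2 ∂P) * ((τ m (j + 1) : ℝ) - τ m j) ≤
            σ ^ 2 * ((K : ℝ) ^ 2 * (σ ^ 2) ^ n / n.factorial) *
              ((τ m j : ℝ) ^ n * ((τ m (j + 1) : ℝ) - τ m j)) := by
          have hΔ : 0 ≤ (τ m (j + 1) : ℝ) - τ m j :=
            sub_nonneg.2 ((hτ m).mono (Nat.le_succ j))
          simp_rw [mul_pow σ]
          rw [integral_const_mul]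
          have := ih _ (((hτ m).le j).trans hu)
          calc _ ≤ σ ^ 2 * ((K : ℝ) ^ 2 * ((σ ^ 2 * τ m j) ^ n / n.factorial)) *
                ((τ m (j + 1) : ℝ) - τ m j) := by gcongr
            _ = _ := by rw [mul_pow (σ ^ 2)]; ring
        refine (Finset.sum_le_sum fun j _ ↦ hterm j).trans ?_
        rw [← Finset.mul_sum]
        calc _ ≤ σ ^ 2 * ((K : ℝ) ^ 2 * (σ ^ 2) ^ n / n.factorial) *
              ((u : ℝ) ^ (n + 1) / (n + 1)) := by
              gcongr
              exact (hτ m).sum_pow_mul_sub_le n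
          _ = C := by
              simp only [C, Nat.factorial_succ]
              push_cast
              field_simp
              ring
      -- A path bounded up to `u` is bounded up to every partition point, so on this event `X` and
      -- `D` agree there.
      have hYae m : (boundedUpTo D K u).indicator (fun ω ↦ ∑ j ∈ Finset.range (N m),
          σ * D (τ m j) ω * (B (τ m (j + 1)) ω - B (τ m j) ω)) =ᵐ[P]
          (boundedUpTo D K u).indicator (Y m) := by
        filter_upwards [hc] with ω hω
        by_cases hmem : ω ∈ boundedUpTo D K u
        · rw [Set.indicator_of_mem hmem, Set.indicator_of_mem hmem]
          refine Finset.sum_congr rfl fun j _ ↦ ?_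
          have hju := (hτ m).le j
          have hmem' : ω ∈ boundedUpTo D K (τ m j) :=
            (mem_boundedUpTo_iff hω (hju.trans hu)).2 fun v hv ↦
              (mem_boundedUpTo_iff hω hu).1 hmem v (hv.trans hju)
          simp only [hX, Set.indicator_of_mem hmem']
        · rw [Set.indicator_of_notMem hmem, Set.indicator_of_notMem hmem]
      have hlim'' := hlim'.congr_left hYae
      -- The $L^2$ norm is lower semicontinuous under convergence in measure.
      have hle := eLpNorm_le_of_tendstoInMeasure (p := 2) (C := ENNReal.ofReal (√C))
        (Eventually.of_forall fun m ↦ by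
          refine (eLpNorm_indicator_le (Y m)).trans ?_
          rw [eLpNorm_two_eq_ofReal_sqrt (hYI m).1]
          exact ENNReal.ofReal_le_ofReal (Real.sqrt_le_sqrt (hYC m))) hlim''
        (fun m ↦ (hYI m).1.aestronglyMeasurable.indicator hAm)
      rw [eLpNorm_two_eq_ofReal_sqrt (hX2 K u hu),
        ENNReal.ofReal_le_ofReal_iff (Real.sqrt_nonneg _)] at hle
      exact (Real.sqrt_le_sqrt_iff hC).1 hle
  have hzero (K : ℕ) : ∀ᵐ ω ∂P, X K t ω = 0 := by
    have hlim : Tendsto (fun n : ℕ ↦ (K : ℝ) ^ 2 * ((σ ^ 2 * t) ^ n / n.factorial)) atTop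
        (𝓝 ((K : ℝ) ^ 2 * 0)) :=
      (FloorSemiring.tendsto_pow_div_factorial_atTop (σ ^ 2 * (t : ℝ))).const_mul _
    have hle : ∫ ω, X K t ω ^ 2 ∂P ≤ (K : ℝ) ^ 2 * 0 :=
      ge_of_tendsto' hlim fun n ↦ hbound K n t ht
    have h0 : ∫ ω, X K t ω ^ 2 ∂P = 0 :=
      le_antisymm (by simpa using hle) (integral_nonneg fun ω ↦ sq_nonneg _)
    have := (integral_eq_zero_iff_of_nonneg (fun ω ↦ sq_nonneg (X K t ω))
      (hX2 K t ht).integrable_sq).1 h0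
    filter_upwards [this] with ω hω
    simpa using hω
  filter_upwards [hc, ae_all_iff.2 hzero] with ω hω h0
  -- A continuous path is bounded on `[0, t]`, so for some integer `K` the truncation is inactive on
  -- it.
  have hcpt : IsCompact (Set.Iic t) := by
    rw [← Set.Icc_bot]; exact isCompact_Icc
  obtain ⟨C, hC⟩ := hcpt.exists_bound_of_continuousOn (hω.mono (Set.Iic_subset_Iic.2 ht))
  obtain ⟨K, hK⟩ := exists_nat_ge C
  have hmem : ω ∈ boundedUpTo D K t :=
    (mem_boundedUpTo_iff hω ht).2 fun v hv ↦ (hC v hv).trans hK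
  have := h0 K
  simpa only [hX, Set.indicator_of_mem hmem] using this

/-- The solution of `dS^i = σ_i S^i dW^i` is a geometric Brownian motion. -/
lemma IsSolution.ae_eq_expMartingale [IsProbabilityMeasure P] {d : ℕ} {W : Fin d → ℝ≥0 → Ω → ℝ}
    (hW : IsStandardBrownian P W) {σ z : Fin d → ℝ} {T : ℝ≥0} {S : Fin d → ℝ≥0 → Ω → ℝ}
    (hS : IsSolution P (brownianFiltration P W hW.measurable) W (fun _ ↦ Matrix.diagonal σ) z T S)
    (i : Fin d) {t : ℝ≥0} (ht : t ≤ T) :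
    ∀ᵐ ω ∂P, S i t ω = z i * expMartingale (σ i) (W i) t ω := by
  have hB := hW.isBrownianWrt i
  have hEm u : Measurable[brownianFiltration P W hW.measurable u]
      (expMartingale (σ i) (W i) u) := by
    have := hB.measurable u
    exact ((this.const_mul (σ i)).sub_const _).exp
  have h0 := hB.ae_eq_zero_of_tendsto_leftSum (σ := σ i) (T := T)
    (D := fun u ω ↦ S i u ω - z i * expMartingale (σ i) (W i) u ω)
    (fun u hu ↦ (hS.adapted i u hu).sub ((hEm u).const_mul _))
    (by
      filter_upwards [hS.continuous i, hB.cont] with ω h1 h2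
      refine h1.sub (Continuous.continuousOn ?_)
      unfold expMartingale
      fun_prop)
    (fun u hu ↦ by
      obtain ⟨I, hI, hSI⟩ := hS.equation i u hu
      have hcontS : ∀ᵐ ω ∂P, ContinuousOn (fun v ↦ S i v ω) (Set.Iic u) := by
        filter_upwards [hS.continuous i] with ω h using h.mono (Set.Iic_subset_Iic.2 hu)
      -- Off the diagonal the integrand vanishes, hence all Riemann sums and their limit.
      have hoff j (hj : j ≠ i) : ∀ᵐ ω ∂P, I j ω = 0 := by
        obtain ⟨τ, N, -, hlim⟩ := (hI j).exists_tendsto_leftSum (hW.isBrownianWrt j)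
          (by simp [Matrix.diagonal_apply_ne' σ hj, continuousOn_const])
        simp only [Matrix.diagonal_apply_ne' σ hj, mul_zero, zero_mul,
          Finset.sum_const_zero] at hlim
        refine tendstoInMeasure_ae_unique hlim (g := I j) (h := fun _ ↦ 0) ?_
        intro ε hε
        simp [not_le.2 hε]
      obtain ⟨τ, N, hτ, hlim⟩ := (hI i).exists_tendsto_leftSum hB (by
        filter_upwards [hcontS] with ω h
        exact h.mul continuousOn_const)
      refine ⟨τ, N, hτ, ?_⟩
      -- The partitions found for `S` also serve for the exponential martingale, so the sums can be
      -- subtracted and the initial value `z i` cancels.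
      have hlim2 := tendstoInMeasure_const_mul (hB.tendsto_leftSum_expMartingale (σ i) hτ) (-(z i))
      have hlim3 := tendstoInMeasure_add hlim hlim2
      refine hlim3.congr (fun n ↦ ae_of_all _ fun ω ↦ ?_) ?_
      · simp only
        rw [Finset.mul_sum, ← Finset.sum_add_distrib]
        refine Finset.sum_congr rfl fun j _ ↦ ?_
        simp only [Matrix.diagonal_apply_eq]
        ring
      · have hoff' : ∀ᵐ ω ∂P, ∀ j, j ≠ i → I j ω = 0 := by
          rw [ae_all_iff]
          intro j
          by_cases hj : j = i
          · simp [hj]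
          · filter_upwards [hoff j hj] with ω h _ using h
        filter_upwards [hSI, hoff'] with ω h1 h2
        have h3 : ∑ j, I j ω = I i ω :=
          Finset.sum_eq_single i (fun j _ hj ↦ h2 j hj) (by simp)
        rw [h1, h3]
        ring) ht
  filter_upwards [h0] with ω hω
  linarith

end Uniqueness

/-! ### Integration by parts against Gaussian densities -/

section GaussianCalculus

lemma hasDerivAt_gaussianPDFReal_zero (v : ℝ≥0) (y : ℝ) :
    HasDerivAt (gaussianPDFReal 0 v) (-(y / v) * gaussianPDFReal 0 v y) y := by
  have h : HasDerivAt (fun x : ℝ ↦ -(x - 0) ^ 2 / (2 * v)) (-(y / v)) y := by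
    have := (((hasDerivAt_id y).sub_const 0).pow 2).neg.div_const (2 * (v : ℝ))
    refine this.congr_deriv ?_
    -- For `v = 0`, division by zero makes both derivatives zero.
    by_cases hv : (v : ℝ) = 0
    · simp [hv]
    · simp
      field_simp
  have h2 := h.exp.const_mul (√(2 * Real.pi * v))⁻¹
  have e : gaussianPDFReal 0 v = fun x ↦
      (√(2 * Real.pi * v))⁻¹ * Real.exp (-(x - 0) ^ 2 / (2 * v)) := rfl
  rw [e]
  refine h2.congr_deriv ?_
  ring

lemma integrable_gaussianPDFReal_mul_iff {v : ℝ≥0} (hv : v ≠ 0) {f : ℝ → ℝ} :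
    Integrable (fun y ↦ gaussianPDFReal 0 v y * f y) ↔ Integrable f (gaussianReal 0 v) := by
  rw [gaussianReal_of_var_ne_zero 0 hv, integrable_withDensity_iff_integrable_smul'
    (measurable_gaussianPDF _ _) (ae_of_all _ fun _ ↦ gaussianPDF_lt_top)]
  simp [toReal_gaussianPDF]

lemma continuous_gaussianPDFReal_zero (v : ℝ≥0) : Continuous (gaussianPDFReal 0 v) :=
  continuous_iff_continuousAt.2 fun y ↦ (hasDerivAt_gaussianPDFReal_zero v y).continuousAt

lemma gaussianPDFReal_zero_le (v : ℝ≥0) (y : ℝ) :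
    ‖gaussianPDFReal 0 v y‖ ≤ (√(2 * Real.pi * v))⁻¹ := by
  rw [Real.norm_of_nonneg (gaussianPDFReal_nonneg _ _ _), gaussianPDFReal]
  refine mul_le_of_le_one_right (by positivity) (Real.exp_le_one_iff.2 ?_)
  refine div_nonpos_of_nonpos_of_nonneg (neg_nonpos.2 (sq_nonneg _)) (by positivity)

/-- This form covers both the primitive and its derivative in the integration by parts. One density
gives integrability and the other is merely bounded. -/
lemma integrable_affine_mul_exp_mul_gaussianPDFReal {s : ℝ≥0} (hs : s ≠ 0) (v : ℝ≥0)
    (a b c u : ℝ) :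
    Integrable (fun y ↦ gaussianPDFReal 0 s y * gaussianPDFReal 0 v (u - y) *
      ((a * y + b) * Real.exp (c * y))) := by
  have h1 : Integrable (fun y ↦ (a * y + b) * Real.exp (c * y)) (gaussianReal 0 s) := by
    have := ((integrable_mul_exp_mul_gaussianReal c s).const_mul a).add
      ((integrable_exp_mul_gaussianReal (μ := 0) (v := s) c).const_mul b)
    refine this.congr (ae_of_all _ fun y ↦ ?_)
    simp only [Pi.add_apply]; ring
  have h2 := (integrable_gaussianPDFReal_mul_iff hs).2 h1
  have h3 := h2.bdd_mul (c := (√(2 * Real.pi * v))⁻¹)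
    (f := fun y ↦ gaussianPDFReal 0 v (u - y))
    ((continuous_gaussianPDFReal_zero v).comp (by fun_prop)).aestronglyMeasurable
    (ae_of_all _ fun y ↦ gaussianPDFReal_zero_le v (u - y))
  refine h3.congr (ae_of_all _ fun y ↦ ?_)
  simp only; ring

/-- Integration by parts behind the weights: for fixed terminal value `u`, the weight integrates
against the Gaussian densities to a boundary term. -/
lemma integral_heaviside_weight {σ z x a : ℝ} {s v : ℝ≥0} (hσ : σ ≠ 0) (hz : 0 < z)
    (hs : s ≠ 0) (hv : v ≠ 0) (ha : z * Real.exp (σ * a - σ ^ 2 * s / 2) = x) (u : ℝ) :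
    ∫ y, gaussianPDFReal 0 s y * gaussianPDFReal 0 v (u - y) *
      (heaviside (z * Real.exp (σ * y - σ ^ 2 * s / 2) - x) * (v * (y + σ * s) - s * (u - y)) /
        (σ * s * v * (z * Real.exp (σ * y - σ ^ 2 * s / 2)))) =
      gaussianPDFReal 0 s a / (|σ| * x) * gaussianPDFReal 0 v (u - a) := by
  have hs' : (s : ℝ) ≠ 0 := by exact_mod_cast hs
  have hv' : (v : ℝ) ≠ 0 := by exact_mod_cast hv
  have hx : 0 < x := ha ▸ mul_pos hz (Real.exp_pos _)
  -- Chosen so that $c_0e^{-\sigma y}=1/(\sigma S_s)$ when $W_s=y$.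
  set c₀ : ℝ := Real.exp (σ ^ 2 * s / 2) / (σ * z) with hc₀
  have hinv y : Real.exp (σ * y - σ ^ 2 * s / 2) * (Real.exp (σ ^ 2 * s / 2) * Real.exp (-σ * y)) =
      1 := by
    rw [← Real.exp_add, ← Real.exp_add, Real.exp_eq_one_iff]; ring
  -- Minus the product of densities over $\sigma S_s$. Differentiating brings down the factor
  -- $y/s+\sigma-(u-y)/v$, which is the weight divided by `s * v`. The term `0 * y` matches the
  -- affine integrability lemma.
  set ψ : ℝ → ℝ := fun y ↦ -(gaussianPDFReal 0 s y * gaussianPDFReal 0 v (u - y) *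
    ((0 * y + c₀) * Real.exp (-σ * y))) with hψ
  set ψ' : ℝ → ℝ := fun y ↦ gaussianPDFReal 0 s y * gaussianPDFReal 0 v (u - y) *
    ((c₀ * (1 / s + 1 / v) * y + c₀ * (σ - u / v)) * Real.exp (-σ * y)) with hψ'
  have hψi : Integrable ψ := (integrable_affine_mul_exp_mul_gaussianPDFReal hs v _ _ _ _).neg
  have hψi' : Integrable ψ' := integrable_affine_mul_exp_mul_gaussianPDFReal hs v _ _ _ _
  have hderiv y : HasDerivAt ψ (ψ' y) y := by
    have h1 := hasDerivAt_gaussianPDFReal_zero s y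
    have h2 : HasDerivAt (fun y ↦ gaussianPDFReal 0 v (u - y))
        (-(-((u - y) / v) * gaussianPDFReal 0 v (u - y))) y := by
      have := (hasDerivAt_gaussianPDFReal_zero v (u - y)).comp y ((hasDerivAt_id y).const_sub u)
      refine this.congr_deriv ?_
      ring
    have h3 : HasDerivAt (fun y ↦ (0 * y + c₀) * Real.exp (-σ * y))
        (c₀ * (Real.exp (-σ * y) * -σ)) y := by
      have : HasDerivAt (fun y ↦ Real.exp (-σ * y)) (Real.exp (-σ * y) * -σ) y := by
        have := ((hasDerivAt_id y).const_mul (-σ)).exp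
        refine this.congr_deriv ?_
        simp
      simpa using this.const_mul c₀
    have h4 := ((h1.mul h2).mul h3).neg
    refine h4.congr_deriv ?_
    simp only [hψ', Pi.mul_apply]
    field_simp
    ring
  have hψa : ψ a = -(gaussianPDFReal 0 s a * gaussianPDFReal 0 v (u - a) / (σ * x)) := by
    have e2 : Real.exp (σ ^ 2 * s / 2) * Real.exp (-σ * a) =
        (Real.exp (σ * a - σ ^ 2 * s / 2))⁻¹ := eq_inv_of_mul_eq_one_right (hinv a)
    have e3 : (0 * a + Real.exp (σ ^ 2 * s / 2) / (σ * z)) * Real.exp (-σ * a) =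
        Real.exp (σ ^ 2 * s / 2) * Real.exp (-σ * a) / (σ * z) := by ring
    simp only [hψ, hc₀]
    rw [e3, e2, ← ha]
    ring
  have hintegrand y : gaussianPDFReal 0 s y * gaussianPDFReal 0 v (u - y) *
      (heaviside (z * Real.exp (σ * y - σ ^ 2 * s / 2) - x) * (v * (y + σ * s) - s * (u - y)) /
        (σ * s * v * (z * Real.exp (σ * y - σ ^ 2 * s / 2)))) =
      {y | σ * a ≤ σ * y}.indicator ψ' y := by
    have hiff : 0 ≤ z * Real.exp (σ * y - σ ^ 2 * s / 2) - x ↔ σ * a ≤ σ * y := by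
      rw [← ha, sub_nonneg, mul_le_mul_iff_right₀ hz, Real.exp_le_exp]
      constructor <;> intro h <;> linarith
    simp only [heaviside, hiff, Set.indicator, Set.mem_ofPred_eq]
    split_ifs with h
    · have h1 := hinv y
      simp only [hψ', hc₀]
      have he := (Real.exp_pos (σ * y - σ ^ 2 * s / 2)).ne'
      have e2 : Real.exp (σ ^ 2 * s / 2) * Real.exp (-σ * y) =
          (Real.exp (σ * y - σ ^ 2 * s / 2))⁻¹ := eq_inv_of_mul_eq_one_right h1
      have e3 : (Real.exp (σ ^ 2 * s / 2) / (σ * z) * (1 / s + 1 / v) * y +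
          Real.exp (σ ^ 2 * s / 2) / (σ * z) * (σ - u / v)) * Real.exp (-σ * y) =
          ((1 / s + 1 / v) * y + (σ - u / v)) / (σ * z) *
            (Real.exp (σ ^ 2 * s / 2) * Real.exp (-σ * y)) := by ring
      rw [e3, e2]
      field_simp
      ring
    · simp
  simp_rw [hintegrand]
  -- The half-line lies left of `a` for `σ < 0` and right of it for `σ > 0`. `ψ` vanishes at the
  -- infinite end, and the sign of the boundary term turns `σ` into `|σ|`.
  rcases lt_or_gt_of_ne hσ with hneg | hpos
  · have hset : {y | σ * a ≤ σ * y} = Set.Iic a := by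
      ext y; simp [mul_le_mul_left_of_neg hneg]
    rw [hset, integral_indicator measurableSet_Iic,
      integral_Iic_of_hasDerivAt_of_tendsto' (fun y _ ↦ hderiv y) hψi'.integrableOn
        (tendsto_zero_of_hasDerivAt_of_integrableOn_Iic (a := a) (fun y _ ↦ hderiv y)
          hψi'.integrableOn hψi.integrableOn), hψa, abs_of_neg hneg]
    field_simp
    simp
  · have hset : {y | σ * a ≤ σ * y} = Set.Ici a := by
      ext y; simp [mul_le_mul_iff_right₀ hpos]
    rw [hset, integral_indicator measurableSet_Ici, integral_Ici_eq_integral_Ioi,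
      integral_Ioi_of_hasDerivAt_of_tendsto' (fun y _ ↦ hderiv y) hψi'.integrableOn
        (tendsto_zero_of_hasDerivAt_of_integrableOn_Ioi (a := a) (fun y _ ↦ hderiv y)
          hψi'.integrableOn hψi.integrableOn), hψa, abs_of_pos hpos]
    field_simp
    simp

/-- The law of `d` independent centred Gaussian variables of variance `v`. -/
noncomputable def gaussianPi (d : ℕ) (v : ℝ≥0) : Measure (Fin d → ℝ) :=
  Measure.pi fun _ ↦ gaussianReal 0 v

instance (d : ℕ) (v : ℝ≥0) : IsProbabilityMeasure (gaussianPi d v) := by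
  unfold gaussianPi; infer_instance

/-- The density of `gaussianPi d v`. -/
noncomputable def gaussianPiPDF {d : ℕ} (v : ℝ≥0) (y : Fin d → ℝ) : ℝ :=
  ∏ k, gaussianPDFReal 0 v (y k)

lemma gaussianPiPDF_nonneg {d : ℕ} (v : ℝ≥0) (y : Fin d → ℝ) : 0 ≤ gaussianPiPDF v y :=
  Finset.prod_nonneg fun _ _ ↦ gaussianPDFReal_nonneg _ _ _

lemma measurable_gaussianPiPDF {d : ℕ} (v : ℝ≥0) :
    Measurable (gaussianPiPDF v : (Fin d → ℝ) → ℝ) :=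
  Finset.measurable_fun_prod _ fun k _ ↦
    (measurable_gaussianPDFReal 0 v).comp (measurable_pi_apply k)

lemma gaussianPi_eq_withDensity (d : ℕ) {v : ℝ≥0} (hv : v ≠ 0) :
    gaussianPi d v = volume.withDensity fun y ↦ ENNReal.ofReal (gaussianPiPDF v y) := by
  refine Measure.pi_eq fun A hA ↦ ?_
  have hi k : Integrable ((A k).indicator (gaussianPDFReal 0 v)) :=
    (integrable_gaussianPDFReal 0 v).indicator (hA k)
  rw [withDensity_apply _ (MeasurableSet.univ_pi hA),
    ← lintegral_indicator (MeasurableSet.univ_pi hA)]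
  have e (y : Fin d → ℝ) : (Set.univ.pi A).indicator
      (fun y ↦ ENNReal.ofReal (gaussianPiPDF v y)) y =
      ENNReal.ofReal (∏ k, (A k).indicator (gaussianPDFReal 0 v) (y k)) := by
    by_cases hy : y ∈ Set.univ.pi A
    · rw [Set.indicator_of_mem hy, gaussianPiPDF]
      congr 1
      exact Finset.prod_congr rfl fun k _ ↦ (Set.indicator_of_mem (hy k (Set.mem_univ k)) _).symm
    · rw [Set.indicator_of_notMem hy]
      obtain ⟨k, hk⟩ : ∃ k, y k ∉ A k := by simpa [Set.mem_pi] using hy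
      rw [Finset.prod_eq_zero (Finset.mem_univ k) (Set.indicator_of_notMem hk _)]
      simp
  simp_rw [e]
  rw [← ofReal_integral_eq_lintegral_ofReal, integral_fintype_prod_volume_eq_prod
    (fun k ↦ (A k).indicator (gaussianPDFReal 0 v)), ENNReal.ofReal_prod_of_nonneg]
  · refine Finset.prod_congr rfl fun k _ ↦ ?_
    rw [integral_indicator (hA k), gaussianReal_apply_eq_integral 0 hv]
  · exact fun k _ ↦ integral_nonneg fun y ↦
      Set.indicator_nonneg (fun _ _ ↦ gaussianPDFReal_nonneg _ _ _) _
  · exact Integrable.fintype_prod (f := fun k ↦ (A k).indicator (gaussianPDFReal 0 v)) hi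
  · exact ae_of_all _ fun y ↦ Finset.prod_nonneg fun k _ ↦
      Set.indicator_nonneg (fun _ _ ↦ gaussianPDFReal_nonneg _ _ _) _

lemma integral_gaussianPi (d : ℕ) {v : ℝ≥0} (hv : v ≠ 0) (f : (Fin d → ℝ) → ℝ) :
    ∫ w, f w ∂gaussianPi d v = ∫ w, gaussianPiPDF v w * f w := by
  rw [gaussianPi_eq_withDensity d hv, integral_withDensity_eq_integral_toReal_smul
    (measurable_gaussianPiPDF v).ennreal_ofReal (ae_of_all _ fun _ ↦ ENNReal.ofReal_lt_top)]
  simp [ENNReal.toReal_ofReal (gaussianPiPDF_nonneg _ _)]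

/-- Fubini's theorem in the coordinates `(y, u) = (y, y + w)`. -/
lemma integral_gaussianPi_prod {d : ℕ} {s v : ℝ≥0} (hs : s ≠ 0) (hv : v ≠ 0)
    {f : (Fin d → ℝ) × (Fin d → ℝ) → ℝ}
    (hf : Integrable f ((gaussianPi d s).prod (gaussianPi d v))) :
    ∫ p, f p ∂(gaussianPi d s).prod (gaussianPi d v) =
      ∫ u, ∫ y, gaussianPiPDF s y * gaussianPiPDF v (u - y) * f (y, u - y) := by
  -- The full integrand in the sheared coordinates; the shear preserves Lebesgue measure.
  set K : (Fin d → ℝ) × (Fin d → ℝ) → ℝ := fun p ↦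
    gaussianPiPDF s p.1 * gaussianPiPDF v (p.2 - p.1) * f (p.1, p.2 - p.1) with hK
  have hmeas : (gaussianPi d s).prod (gaussianPi d v) = (volume.prod volume).withDensity
      fun p ↦ ENNReal.ofReal (gaussianPiPDF s p.1 * gaussianPiPDF v p.2) := by
    rw [gaussianPi_eq_withDensity d hs, gaussianPi_eq_withDensity d hv,
      prod_withDensity (measurable_gaussianPiPDF s).ennreal_ofReal
        (measurable_gaussianPiPDF v).ennreal_ofReal]
    congr 1
    funext p
    rw [ENNReal.ofReal_mul (gaussianPiPDF_nonneg _ _)]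
  have hdm : Measurable fun p : (Fin d → ℝ) × (Fin d → ℝ) ↦
      ENNReal.ofReal (gaussianPiPDF s p.1 * gaussianPiPDF v p.2) :=
    (((measurable_gaussianPiPDF s).comp measurable_fst).mul
      ((measurable_gaussianPiPDF v).comp measurable_snd)).ennreal_ofReal
  have hnn (p : (Fin d → ℝ) × (Fin d → ℝ)) : 0 ≤ gaussianPiPDF s p.1 * gaussianPiPDF v p.2 :=
    mul_nonneg (gaussianPiPDF_nonneg _ _) (gaussianPiPDF_nonneg _ _)
  have hpres := measurePreserving_prod_add (volume : Measure (Fin d → ℝ))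
    (volume : Measure (Fin d → ℝ))
  have hemb : MeasurableEmbedding fun p : (Fin d → ℝ) × (Fin d → ℝ) ↦ (p.1, p.1 + p.2) :=
    (MeasurableEquiv.shearAddRight (Fin d → ℝ)).measurableEmbedding
  have hcomp : (K ∘ fun p ↦ (p.1, p.1 + p.2)) =
      fun p ↦ (ENNReal.ofReal (gaussianPiPDF s p.1 * gaussianPiPDF v p.2)).toReal • f p := by
    funext p
    simp [hK, ENNReal.toReal_ofReal (hnn p)]
  have hKint : Integrable K (volume.prod volume) := by
    rw [← hpres.integrable_comp_emb hemb, hcomp]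
    rw [hmeas, integrable_withDensity_iff_integrable_smul' hdm
      (ae_of_all _ fun _ ↦ ENNReal.ofReal_lt_top)] at hf
    exact hf
  rw [hmeas, integral_withDensity_eq_integral_toReal_smul hdm
    (ae_of_all _ fun _ ↦ ENNReal.ofReal_lt_top)]
  have h1 := hpres.integral_comp hemb K
  have h2 : ∫ p, K (p.1, p.1 + p.2) ∂(volume.prod volume) = ∫ p,
      (ENNReal.ofReal (gaussianPiPDF s p.1 * gaussianPiPDF v p.2)).toReal • f p
        ∂(volume.prod volume) := integral_congr_ae (ae_of_all _ fun p ↦ congrFun hcomp p)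
  rw [← h2, h1, integral_prod_symm K hKint]

end GaussianCalculus

/-! ### Geometric Brownian motion and the weights in Gaussian coordinates -/

section GaussianModel

variable {d : ℕ}

/-- Geometric Brownian motion at time `r` as a function of the value `y` of the Brownian motion. -/
noncomputable def gbm (σ z : Fin d → ℝ) (r : ℝ≥0) (y : Fin d → ℝ) (k : Fin d) : ℝ :=
  z k * Real.exp (σ k * y k - σ k ^ 2 * r / 2)

lemma gbm_pos {σ z : Fin d → ℝ} (hz : ∀ k, 0 < z k) (r : ℝ≥0) (y : Fin d → ℝ) (k : Fin d) :
    0 < gbm σ z r y k := mul_pos (hz k) (Real.exp_pos _)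

lemma continuous_gbm (σ z : Fin d → ℝ) (r : ℝ≥0) : Continuous (gbm σ z r) := by
  unfold gbm
  fun_prop

/-- The inverse of `gbm` on the positive orthant. -/
noncomputable def gbmInv (σ z : Fin d → ℝ) (r : ℝ≥0) (x : Fin d → ℝ) (k : Fin d) : ℝ :=
  (Real.log (x k / z k) + σ k ^ 2 * r / 2) / σ k

lemma gbm_gbmInv {σ z : Fin d → ℝ} (hσ : ∀ k, σ k ≠ 0) (hz : ∀ k, 0 < z k) (r : ℝ≥0)
    {x : Fin d → ℝ} (hx : ∀ k, 0 < x k) : gbm σ z r (gbmInv σ z r x) = x := by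
  funext k
  have h1 : σ k * gbmInv σ z r x k - σ k ^ 2 * r / 2 = Real.log (x k / z k) := by
    have := hσ k
    simp only [gbmInv]
    field_simp
    ring
  rw [gbm, h1, Real.exp_log (div_pos (hx k) (hz k)), mul_div_cancel₀ _ (hz k).ne']

lemma gbmInv_gbm {σ z : Fin d → ℝ} (hσ : ∀ k, σ k ≠ 0) (hz : ∀ k, 0 < z k) (r : ℝ≥0)
    (y : Fin d → ℝ) : gbmInv σ z r (gbm σ z r y) = y := by
  funext k
  have h1 := hσ k
  rw [gbmInv, gbm, mul_div_cancel_left₀ _ (hz k).ne', Real.log_exp]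
  field_simp
  ring

lemma measurable_gbmInv (σ z : Fin d → ℝ) (r : ℝ≥0) : Measurable (gbmInv σ z r) := by
  refine measurable_pi_lambda _ fun k ↦ ?_
  exact ((Real.measurable_log.comp ((measurable_pi_apply k).div_const _)).add_const _).div_const _

lemma continuousAt_gbmInv {σ z : Fin d → ℝ} (hz : ∀ k, 0 < z k) (r : ℝ≥0) {x : Fin d → ℝ}
    (hx : ∀ k, 0 < x k) : ContinuousAt (gbmInv σ z r) x := by
  refine continuousAt_pi.2 fun k ↦ ?_
  refine ContinuousAt.div_const (ContinuousAt.add ?_ continuousAt_const) _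
  exact ContinuousAt.log ((continuous_apply k).continuousAt.div_const _)
    (ne_of_gt (div_pos (hx k) (hz k)))

/-- The product of the weights `H(S^k_s - x_k) W^k_{s,t} / (σ_k s v S^k_s)`, `v = t - s`, as a
function of the value at time `s` and of the increment up to time `t` of the Brownian motion. -/
noncomputable def weightProd (σ z : Fin d → ℝ) (s v : ℝ≥0) (x : Fin d → ℝ)
    (p : (Fin d → ℝ) × (Fin d → ℝ)) : ℝ :=
  ∏ k, heaviside (gbm σ z s p.1 k - x k) * (v * (p.1 k + σ k * s) - s * p.2 k) /
    (σ k * s * v * gbm σ z s p.1 k)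

lemma measurable_heaviside : Measurable heaviside :=
  Measurable.ite measurableSet_Ici measurable_const measurable_const

lemma measurable_weightProd (σ z : Fin d → ℝ) (s v : ℝ≥0) (x : Fin d → ℝ) :
    Measurable (weightProd σ z s v x) := by
  have hg k : Measurable fun p : (Fin d → ℝ) × (Fin d → ℝ) ↦ gbm σ z s p.1 k :=
    (measurable_pi_apply k).comp ((continuous_gbm σ z s).measurable.comp measurable_fst)
  refine Finset.measurable_fun_prod _ fun k _ ↦ ?_
  refine Measurable.div (Measurable.mul (measurable_heaviside.comp ((hg k).sub_const _)) ?_)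
    ((hg k).const_mul _)
  fun_prop

/-- Turns polynomial growth into a bound that factorizes, reducing integrability to one dimension.
-/
lemma one_add_norm_le_prod (y : Fin d → ℝ) : 1 + ‖y‖ ≤ ∏ k, (1 + |y k|) := by
  have h1 : ∀ k, 1 ≤ 1 + |y k| := fun k ↦ by linarith [abs_nonneg (y k)]
  have hp : 1 ≤ ∏ k, (1 + |y k|) := by
    have := Finset.prod_le_prod (s := Finset.univ) (f := fun _ : Fin d ↦ (1 : ℝ))
      (g := fun k ↦ 1 + |y k|) (fun _ _ ↦ zero_le_one) fun k _ ↦ h1 k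
    simpa using this
  rw [← le_sub_iff_add_le']
  refine (pi_norm_le_iff_of_nonneg (by linarith)).2 fun k ↦ ?_
  rw [le_sub_iff_add_le', Real.norm_eq_abs]
  have h2 : 1 ≤ ∏ j ∈ Finset.univ.erase k, (1 + |y j|) := by
    have := Finset.prod_le_prod (s := Finset.univ.erase k) (f := fun _ : Fin d ↦ (1 : ℝ))
      (g := fun k ↦ 1 + |y k|) (fun _ _ ↦ zero_le_one) fun k _ ↦ h1 k
    simpa using this
  rw [← Finset.mul_prod_erase _ _ (Finset.mem_univ k)]
  exact le_mul_of_one_le_right (by linarith [abs_nonneg (y k)]) h2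

lemma PolyGrowth.abs_comp_gbm_le {g : (Fin d → ℝ) → ℝ} (hg : PolyGrowth g) {σ z : Fin d → ℝ}
    (hz : ∀ k, 0 < z k) (r : ℝ≥0) : ∃ C ≥ 0, ∃ m : ℕ, ∀ y,
      |g (gbm σ z r y)| ≤ C * ∏ k, Real.exp (m * |σ k| * |y k|) := by
  obtain ⟨-, C, hC, m, hgm⟩ := hg
  refine ⟨C * ∏ k, (1 + z k) ^ m, mul_nonneg hC.le
    (Finset.prod_nonneg fun k _ ↦ by have := hz k; positivity), m, fun y ↦ ?_⟩
  refine (hgm _).trans ?_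
  rw [mul_assoc, ← Finset.prod_mul_distrib]
  refine mul_le_mul_of_nonneg_left ?_ hC.le
  calc (1 + ‖gbm σ z r y‖) ^ m ≤ (∏ k, (1 + |gbm σ z r y k|)) ^ m :=
        pow_le_pow_left₀ (by positivity) (one_add_norm_le_prod _) m
    _ = ∏ k, (1 + |gbm σ z r y k|) ^ m := (Finset.prod_pow _ _ _).symm
    _ ≤ ∏ k, ((1 + z k) ^ m * Real.exp (m * |σ k| * |y k|)) := by
        refine Finset.prod_le_prod (fun k _ ↦ by positivity) fun k _ ↦ ?_
        rw [mul_assoc (m : ℝ), Real.exp_nat_mul, ← mul_pow]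
        refine pow_le_pow_left₀ (by positivity) ?_ m
        rw [abs_of_pos (gbm_pos hz r y k), gbm]
        have h1 : Real.exp (σ k * y k - σ k ^ 2 * r / 2) ≤ Real.exp (|σ k| * |y k|) := by
          rw [Real.exp_le_exp, ← abs_mul]
          have : 0 ≤ σ k ^ 2 * (r : ℝ) / 2 := by positivity
          linarith [le_abs_self (σ k * y k)]
        have h2 : 1 ≤ Real.exp (|σ k| * |y k|) := Real.one_le_exp (by positivity)
        nlinarith [hz k]

/-- The Heaviside factor is at most one, the affine numerator is dominated by exponentials, and
$1/S_s$ costs a factor $e^{|\sigma||y|}$ up to a constant. -/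
lemma abs_weightProd_le {σ z : Fin d → ℝ} (hσ : ∀ k, σ k ≠ 0) (hz : ∀ k, 0 < z k) {s v : ℝ≥0}
    (hs : s ≠ 0) (hv : v ≠ 0) (x : Fin d → ℝ) : ∃ C ≥ 0, ∀ p, |weightProd σ z s v x p| ≤
      C * ∏ k, (Real.exp ((|σ k| + 1) * |p.1 k|) * Real.exp (|p.2 k|)) := by
  have hs' : (0 : ℝ) < s := by exact_mod_cast pos_iff_ne_zero.2 hs
  have hv' : (0 : ℝ) < v := by exact_mod_cast pos_iff_ne_zero.2 hv
  set M : Fin d → ℝ := fun k ↦ (v + v * (|σ k| * s) + s) * Real.exp (σ k ^ 2 * s / 2) /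
    (|σ k| * s * v * z k) with hM
  have hσ' k : 0 < |σ k| := abs_pos.2 (hσ k)
  have hMnn k : 0 ≤ M k := by have := hz k; have := hσ' k; positivity
  refine ⟨∏ k, M k, Finset.prod_nonneg fun k _ ↦ hMnn k, fun p ↦ ?_⟩
  rw [weightProd, Finset.abs_prod, ← Finset.prod_mul_distrib]
  refine Finset.prod_le_prod (fun k _ ↦ abs_nonneg _) fun k _ ↦ ?_
  have hz' := hz k
  have hσ'' := hσ' k
  have hH : |heaviside (gbm σ z s p.1 k - x k)| ≤ 1 := by
    unfold heaviside; split_ifs <;> simp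
  have ey : 1 + |p.1 k| ≤ Real.exp |p.1 k| := by linarith [Real.add_one_le_exp |p.1 k|]
  have ew : 1 + |p.2 k| ≤ Real.exp |p.2 k| := by linarith [Real.add_one_le_exp |p.2 k|]
  have hnum : |(v : ℝ) * (p.1 k + σ k * s) - s * p.2 k| ≤
      (v + v * (|σ k| * s) + s) * (Real.exp |p.1 k| * Real.exp |p.2 k|) := by
    have h1 : |(v : ℝ) * (p.1 k + σ k * s) - s * p.2 k| ≤
        v * (|p.1 k| + |σ k| * s) + s * |p.2 k| := by
      refine (abs_sub _ _).trans ?_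
      rw [abs_mul, abs_mul, abs_of_pos hv', abs_of_pos hs']
      gcongr
      refine (abs_add_le _ _).trans ?_
      rw [abs_mul, abs_of_pos hs']
    have hy1 : |p.1 k| ≤ Real.exp |p.1 k| * Real.exp |p.2 k| := by
      nlinarith [abs_nonneg (p.1 k), abs_nonneg (p.2 k)]
    have hw1 : |p.2 k| ≤ Real.exp |p.1 k| * Real.exp |p.2 k| := by
      nlinarith [abs_nonneg (p.1 k), abs_nonneg (p.2 k)]
    have h11 : 1 ≤ Real.exp |p.1 k| * Real.exp |p.2 k| := by
      nlinarith [abs_nonneg (p.1 k), abs_nonneg (p.2 k)]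
    have hb : 0 ≤ v * (|σ k| * (s : ℝ)) := by positivity
    nlinarith
  have hden : |σ k * s * v * gbm σ z s p.1 k| =
      |σ k| * s * v * z k * Real.exp (σ k * p.1 k - σ k ^ 2 * s / 2) := by
    rw [abs_mul, abs_mul, abs_mul, abs_of_pos hs', abs_of_pos hv',
      abs_of_pos (gbm_pos hz s p.1 k), gbm]
    ring
  have hexp : (Real.exp (σ k * p.1 k - σ k ^ 2 * s / 2))⁻¹ ≤
      Real.exp (σ k ^ 2 * s / 2) * Real.exp (|σ k| * |p.1 k|) := by
    rw [← Real.exp_neg, ← Real.exp_add, Real.exp_le_exp, ← abs_mul]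
    linarith [neg_abs_le (σ k * p.1 k)]
  rw [abs_div, abs_mul, hden]
  calc _ ≤ 1 * ((v + v * (|σ k| * s) + s) * (Real.exp |p.1 k| * Real.exp |p.2 k|)) /
        (|σ k| * s * v * z k * Real.exp (σ k * p.1 k - σ k ^ 2 * s / 2)) := by gcongr
    _ = (v + v * (|σ k| * s) + s) * (Real.exp |p.1 k| * Real.exp |p.2 k|) /
        (|σ k| * s * v * z k) * (Real.exp (σ k * p.1 k - σ k ^ 2 * s / 2))⁻¹ := by
        rw [one_mul, div_mul_eq_div_div, div_eq_mul_inv]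
    _ ≤ (v + v * (|σ k| * s) + s) * (Real.exp |p.1 k| * Real.exp |p.2 k|) /
        (|σ k| * s * v * z k) * (Real.exp (σ k ^ 2 * s / 2) * Real.exp (|σ k| * |p.1 k|)) := by
        gcongr
    _ = M k * (Real.exp ((|σ k| + 1) * |p.1 k|) * Real.exp |p.2 k|) := by
        rw [add_mul |σ k|, Real.exp_add, one_mul, hM]
        ring

lemma integrable_exp_mul_abs_gaussianReal (c : ℝ) (v : ℝ≥0) :
    Integrable (fun x ↦ Real.exp (c * |x|)) (gaussianReal 0 v) :=
  integrable_exp_mul_abs (X := fun x : ℝ ↦ x) (integrable_exp_mul_gaussianReal c)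
    (integrable_exp_mul_gaussianReal (-c))

lemma integrable_prod_exp_gaussianPi (c : Fin d → ℝ) (v : ℝ≥0) :
    Integrable (fun y : Fin d → ℝ ↦ ∏ k, Real.exp (c k * |y k|)) (gaussianPi d v) :=
  Integrable.fintype_prod (f := fun k x ↦ Real.exp (c k * |x|))
    fun k ↦ integrable_exp_mul_abs_gaussianReal (c k) v

lemma PolyGrowth.abs_comp_gbm_add_le {g : (Fin d → ℝ) → ℝ} (hg : PolyGrowth g) {σ z : Fin d → ℝ}
    (hz : ∀ k, 0 < z k) (r : ℝ≥0) : ∃ C ≥ 0, ∃ m : ℕ, ∀ p : (Fin d → ℝ) × (Fin d → ℝ),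
      |g (gbm σ z r (p.1 + p.2))| ≤ C * ((∏ k, Real.exp (m * |σ k| * |p.1 k|)) *
        ∏ k, Real.exp (m * |σ k| * |p.2 k|)) := by
  obtain ⟨C, hC, m, h⟩ := hg.abs_comp_gbm_le (σ := σ) hz r
  refine ⟨C, hC, m, fun p ↦ (h _).trans (mul_le_mul_of_nonneg_left ?_ hC)⟩
  rw [← Finset.prod_mul_distrib]
  refine Finset.prod_le_prod (fun k _ ↦ (Real.exp_pos _).le) fun k _ ↦ ?_
  rw [← Real.exp_add, Real.exp_le_exp, ← mul_add]
  exact mul_le_mul_of_nonneg_left (abs_add_le _ _) (by positivity)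

lemma PolyGrowth.measurable_comp_gbm_add {g : (Fin d → ℝ) → ℝ} (hg : PolyGrowth g)
    (σ z : Fin d → ℝ) (r : ℝ≥0) :
    Measurable fun p : (Fin d → ℝ) × (Fin d → ℝ) ↦ g (gbm σ z r (p.1 + p.2)) :=
  hg.1.comp ((continuous_gbm σ z r).measurable.comp (measurable_fst.add measurable_snd))

lemma PolyGrowth.integrable_comp_gbm_add {g : (Fin d → ℝ) → ℝ} (hg : PolyGrowth g)
    {σ z : Fin d → ℝ} (hz : ∀ k, 0 < z k) (r s v : ℝ≥0) :
    Integrable (fun p : (Fin d → ℝ) × (Fin d → ℝ) ↦ g (gbm σ z r (p.1 + p.2)))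
      ((gaussianPi d s).prod (gaussianPi d v)) := by
  obtain ⟨C, hC, m, h⟩ := hg.abs_comp_gbm_add_le (σ := σ) hz r
  have hb := ((integrable_prod_exp_gaussianPi (fun k : Fin d ↦ m * |σ k|) s).mul_prod
    (integrable_prod_exp_gaussianPi (fun k : Fin d ↦ m * |σ k|) v)).const_mul C
  exact hb.mono' (hg.measurable_comp_gbm_add σ z r).aestronglyMeasurable (ae_of_all _ h)

lemma PolyGrowth.integrable_mul_weightProd {g : (Fin d → ℝ) → ℝ} (hg : PolyGrowth g)
    {σ z : Fin d → ℝ} (hσ : ∀ k, σ k ≠ 0) (hz : ∀ k, 0 < z k) (r : ℝ≥0) {s v : ℝ≥0}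
    (hs : s ≠ 0) (hv : v ≠ 0) (x : Fin d → ℝ) :
    Integrable (fun p : (Fin d → ℝ) × (Fin d → ℝ) ↦
      g (gbm σ z r (p.1 + p.2)) * weightProd σ z s v x p)
      ((gaussianPi d s).prod (gaussianPi d v)) := by
  obtain ⟨C, hC, m, h⟩ := hg.abs_comp_gbm_add_le (σ := σ) hz r
  obtain ⟨C', hC', h'⟩ := abs_weightProd_le hσ hz hs hv x
  have hb := ((integrable_prod_exp_gaussianPi (fun k : Fin d ↦ m * |σ k| + (|σ k| + 1)) s).mul_prod
    (integrable_prod_exp_gaussianPi (fun k : Fin d ↦ m * |σ k| + 1) v)).const_mul (C * C')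
  refine hb.mono' ((hg.measurable_comp_gbm_add σ z r).mul
    (measurable_weightProd σ z s v x)).aestronglyMeasurable (ae_of_all _ fun p ↦ ?_)
  rw [norm_mul, Real.norm_eq_abs, Real.norm_eq_abs]
  refine (mul_le_mul (h p) (h' p) (abs_nonneg _) ?_).trans_eq ?_
  · exact mul_nonneg hC (mul_nonneg (Finset.prod_nonneg fun k _ ↦ (Real.exp_pos _).le)
      (Finset.prod_nonneg fun k _ ↦ (Real.exp_pos _).le))
  · rw [Finset.prod_mul_distrib]
    have e1 : ∏ k, Real.exp ((m * |σ k| + (|σ k| + 1)) * |p.1 k|) =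
        (∏ k, Real.exp (m * |σ k| * |p.1 k|)) * ∏ k, Real.exp ((|σ k| + 1) * |p.1 k|) := by
      rw [← Finset.prod_mul_distrib]
      exact Finset.prod_congr rfl fun k _ ↦ by rw [← Real.exp_add]; congr 1; ring
    have e2 : ∏ k, Real.exp ((m * |σ k| + 1) * |p.2 k|) =
        (∏ k, Real.exp (m * |σ k| * |p.2 k|)) * ∏ k, Real.exp |p.2 k| := by
      rw [← Finset.prod_mul_distrib]
      exact Finset.prod_congr rfl fun k _ ↦ by rw [← Real.exp_add]; congr 1; ring
    rw [e1, e2]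
    ring

/-- The regression function `E g(S_t)` given that the Brownian motion is at `y` at time `t - v`. -/
noncomputable def transitionMean (σ z : Fin d → ℝ) (t v : ℝ≥0) (g : (Fin d → ℝ) → ℝ)
    (y : Fin d → ℝ) : ℝ := ∫ w, g (gbm σ z t (y + w)) ∂gaussianPi d v

lemma transitionMean_eq_integral (σ z : Fin d → ℝ) (t : ℝ≥0) {v : ℝ≥0} (hv : v ≠ 0)
    (g : (Fin d → ℝ) → ℝ) (y : Fin d → ℝ) :
    transitionMean σ z t v g y = ∫ u, gaussianPiPDF v (u - y) * g (gbm σ z t u) := by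
  rw [transitionMean, integral_gaussianPi d hv, ← integral_sub_right_eq_self _ y]
  simp

/-- The weighted expectation is the density of `S_s` at `x` times the regression function. -/
lemma PolyGrowth.integral_mul_weightProd {g : (Fin d → ℝ) → ℝ} (hg : PolyGrowth g)
    {σ z : Fin d → ℝ} (hσ : ∀ k, σ k ≠ 0) (hz : ∀ k, 0 < z k) (t : ℝ≥0) {s v : ℝ≥0}
    (hs : s ≠ 0) (hv : v ≠ 0) {x a : Fin d → ℝ} (ha : gbm σ z s a = x) :
    ∫ p, g (gbm σ z t (p.1 + p.2)) * weightProd σ z s v x p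
      ∂(gaussianPi d s).prod (gaussianPi d v) =
      (∏ k, gaussianPDFReal 0 s (a k) / (|σ k| * x k)) * transitionMean σ z t v g a := by
  rw [integral_gaussianPi_prod hs hv (hg.integrable_mul_weightProd hσ hz t hs hv x),
    transitionMean_eq_integral _ _ _ hv, ← integral_const_mul]
  refine integral_congr_ae (ae_of_all _ fun u ↦ ?_)
  simp only
  -- For fixed terminal value `u`, `g` no longer depends on `y` and the other factors split over the
  -- coordinates.
  have e (y : Fin d → ℝ) : gaussianPiPDF s y * gaussianPiPDF v (u - y) *
      (g (gbm σ z t (y + (u - y))) * weightProd σ z s v x (y, u - y)) =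
      g (gbm σ z t u) * ∏ k, (gaussianPDFReal 0 s (y k) * gaussianPDFReal 0 v (u k - y k) *
        (heaviside (z k * Real.exp (σ k * y k - σ k ^ 2 * s / 2) - x k) *
          (v * (y k + σ k * s) - s * (u k - y k)) /
          (σ k * s * v * (z k * Real.exp (σ k * y k - σ k ^ 2 * s / 2))))) := by
    rw [add_sub_cancel, Finset.prod_mul_distrib, Finset.prod_mul_distrib]
    simp only [gaussianPiPDF, weightProd, gbm, Pi.sub_apply]
    ring
  simp_rw [e]
  rw [integral_const_mul, integral_fintype_prod_volume_eq_prod (fun k (y : ℝ) ↦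
    gaussianPDFReal 0 s y * gaussianPDFReal 0 v (u k - y) *
        (heaviside (z k * Real.exp (σ k * y - σ k ^ 2 * s / 2) - x k) *
          (v * (y + σ k * s) - s * (u k - y)) /
          (σ k * s * v * (z k * Real.exp (σ k * y - σ k ^ 2 * s / 2)))))]
  simp_rw [fun k ↦ integral_heaviside_weight (hσ k) (hz k) hs hv (congrFun ha k) (u k)]
  rw [Finset.prod_mul_distrib, gaussianPiPDF]
  simp only [Pi.sub_apply]
  ring

lemma gaussianPDFReal_zero_sub {v : ℝ≥0} (hv : v ≠ 0) (u y : ℝ) :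
    gaussianPDFReal 0 v (u - y) =
      gaussianPDFReal 0 v u * Real.exp (u * y / v - y ^ 2 / (2 * v)) := by
  have hv' : (v : ℝ) ≠ 0 := by exact_mod_cast hv
  rw [gaussianPDFReal, gaussianPDFReal, mul_assoc _ (Real.exp _), ← Real.exp_add]
  congr 2
  field_simp
  ring

/-- Shifting the argument of a merely measurable `g` gives no continuity. After this change of
measure `y` enters only through a smooth exponential. -/
lemma transitionMean_eq_integral_tilted (σ z : Fin d → ℝ) (t : ℝ≥0) {v : ℝ≥0} (hv : v ≠ 0)
    (g : (Fin d → ℝ) → ℝ) (y : Fin d → ℝ) :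
    transitionMean σ z t v g y = ∫ u, g (gbm σ z t u) *
      ∏ k, Real.exp (u k * y k / v - y k ^ 2 / (2 * v)) ∂gaussianPi d v := by
  rw [transitionMean_eq_integral _ _ _ hv, integral_gaussianPi d hv]
  refine integral_congr_ae (ae_of_all _ fun u ↦ ?_)
  simp only [gaussianPiPDF, Pi.sub_apply, gaussianPDFReal_zero_sub hv]
  rw [Finset.prod_mul_distrib]
  ring

/-- The regression function is continuous, although `g` is only measurable. -/
lemma PolyGrowth.continuous_transitionMean {g : (Fin d → ℝ) → ℝ} (hg : PolyGrowth g)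
    {σ z : Fin d → ℝ} (hz : ∀ k, 0 < z k) (t : ℝ≥0) {v : ℝ≥0} (hv : v ≠ 0) :
    Continuous (transitionMean σ z t v g) := by
  have hv' : (0 : ℝ) < v := by exact_mod_cast pos_iff_ne_zero.2 hv
  obtain ⟨C, hC, m, h⟩ := hg.abs_comp_gbm_le (σ := σ) hz t
  rw [funext (transitionMean_eq_integral_tilted σ z t hv g)]
  refine continuous_iff_continuousAt.2 fun y₀ ↦ ?_
  -- Bounds all coordinates on the unit ball around `y₀`, so that the dominating function does not
  -- depend on `y`; the Gaussian factor in `y` is at most one.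
  set R : ℝ := ‖y₀‖ + 1
  have hgm : Measurable fun u ↦ g (gbm σ z t u) := hg.1.comp (continuous_gbm σ z t).measurable
  refine continuousAt_of_dominated
    (bound := fun u ↦ C * ∏ k, Real.exp ((m * |σ k| + R / v) * |u k|)) ?_ ?_ ?_ ?_
  · refine Eventually.of_forall fun y ↦ (hgm.mul ?_).aestronglyMeasurable
    fun_prop
  · filter_upwards [Metric.ball_mem_nhds y₀ one_pos] with y hy
    refine ae_of_all _ fun u ↦ ?_
    have hyR k : |y k| ≤ R := by
      have h1 : ‖y k‖ ≤ ‖y‖ := norm_le_pi_norm y k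
      have h2 : ‖y‖ ≤ ‖y₀‖ + ‖y - y₀‖ := norm_le_norm_add_norm_sub' y y₀
      have h3 : ‖y - y₀‖ < 1 := by simpa [dist_eq_norm] using hy
      rw [Real.norm_eq_abs] at h1
      linarith
    rw [norm_mul, Real.norm_eq_abs, Real.norm_eq_abs,
      abs_of_nonneg (Finset.prod_nonneg fun k _ ↦ (Real.exp_pos _).le)]
    refine (mul_le_mul (h u) (?_ : _ ≤ ∏ k, Real.exp (R / v * |u k|))
      (Finset.prod_nonneg fun k _ ↦ (Real.exp_pos _).le)
      (mul_nonneg hC (Finset.prod_nonneg fun k _ ↦ (Real.exp_pos _).le))).trans_eq ?_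
    · refine Finset.prod_le_prod (fun k _ ↦ (Real.exp_pos _).le) fun k _ ↦ ?_
      rw [Real.exp_le_exp]
      have h1 : u k * y k ≤ R * |u k| := by
        refine (le_abs_self _).trans ?_
        rw [abs_mul, mul_comm]
        exact mul_le_mul_of_nonneg_right (hyR k) (abs_nonneg _)
      have h2 : u k * y k / v ≤ R / v * |u k| := by
        rw [div_mul_eq_mul_div]
        exact div_le_div_of_nonneg_right h1 hv'.le
      have h3 : 0 ≤ y k ^ 2 / (2 * (v : ℝ)) := by positivity
      linarith
    · rw [mul_assoc, ← Finset.prod_mul_distrib]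
      congr 1
      exact Finset.prod_congr rfl fun k _ ↦ by rw [← Real.exp_add]; congr 1; ring
  · exact (integrable_prod_exp_gaussianPi _ v).const_mul C
  · refine ae_of_all _ fun u ↦ Continuous.continuousAt ?_
    fun_prop

/-- Ensures that the law of $S_s$ charges every ball around a point of the positive orthant. -/
lemma isOpenPosMeasure_gaussianPi (d : ℕ) {v : ℝ≥0} (hv : v ≠ 0) :
    (gaussianPi d v).IsOpenPosMeasure := by
  have : (gaussianReal 0 v).IsOpenPosMeasure :=
    (gaussianReal_absolutelyContinuous' 0 hv).isOpenPosMeasure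
  unfold gaussianPi
  infer_instance

end GaussianModel

/-! ### Law of the Brownian pair and conditioning at a point -/

section Conditioning

variable {Ω : Type*} [mΩ : MeasurableSpace Ω] {P : Measure Ω} {d : ℕ}

/-- The values at time `s` and the increments from `s` to `t` of a standard Brownian motion. -/
def brownianPair (W : Fin d → ℝ≥0 → Ω → ℝ) (s t : ℝ≥0) (ω : Ω) : (Fin d → ℝ) × (Fin d → ℝ) :=
  (fun k ↦ W k s ω, fun k ↦ W k t ω - W k s ω)

lemma IsStandardBrownian.measurePreserving_brownianPair [IsProbabilityMeasure P]
    {W : Fin d → ℝ≥0 → Ω → ℝ} (hW : IsStandardBrownian P W) {s t : ℝ≥0} (hst : s ≤ t) :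
    MeasurePreserving (brownianPair W s t) P
      ((gaussianPi d s).prod (gaussianPi d (t - s))) := by
  set X : Fin d → Ω → ℝ × ℝ := fun k ω ↦ (W k s ω, W k t ω - W k s ω) with hX
  have hXm k : Measurable (X k) :=
    (hW.measurable k s).prodMk ((hW.measurable k t).sub (hW.measurable k s))
  have hind : iIndepFun X P := by
    have := hW.indep.comp (fun _ (f : ℝ≥0 → ℝ) ↦ (f s, f t - f s))
      (fun _ ↦ (measurable_pi_apply s).prodMk ((measurable_pi_apply t).sub (measurable_pi_apply s)))
    exact this
  have hlaw k : P.map (X k) = (gaussianReal 0 s).prod (gaussianReal 0 (t - s)) := by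
    have hB := hW.isBrownianWrt k
    have hi : IndepFun (W k s) (fun ω ↦ W k t ω - W k s ω) P := by
      rw [IndepFun_iff_Indep]
      exact (indep_of_indep_of_le_right (hB.indep s t hst) (hB.measurable s).comap_le).symm
    have hm : Measurable fun ω ↦ W k t ω - W k s ω := (hW.measurable k t).sub (hW.measurable k s)
    have h := (indepFun_iff_map_prod_eq_prod_map_map (hW.measurable k s).aemeasurable
      hm.aemeasurable).1 hi
    rw [(hB.hasLaw_eval s).map_eq, (hB.hasLaw s t hst).map_eq] at h
    exact h
  have hpi : P.map (fun ω k ↦ X k ω) =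
      Measure.pi fun _ : Fin d ↦ (gaussianReal 0 s).prod (gaussianReal 0 (t - s)) := by
    rw [hind.map_fun_eq_pi_map fun k ↦ (hXm k).aemeasurable]
    simp_rw [hlaw]
  have h1 : MeasurePreserving (fun ω k ↦ X k ω) P
      (Measure.pi fun _ : Fin d ↦ (gaussianReal 0 s).prod (gaussianReal 0 (t - s))) :=
    ⟨measurable_pi_lambda _ hXm, hpi⟩
  -- The family of pairs, one for each coordinate, is regrouped into a pair of vectors.
  exact (measurePreserving_arrowProdEquivProdArrow ℝ ℝ (Fin d) (fun _ ↦ gaussianReal 0 s)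
    (fun _ ↦ gaussianReal 0 (t - s))).comp h1

/-- A version of the conditional expectation which is continuous at `x` gives its value at the
individual point `x`. -/
lemma hasCondExpAt_of_condExp_ae_eq [IsProbabilityMeasure P] {E : Type*} [PseudoMetricSpace E]
    [MeasurableSpace E] [OpensMeasurableSpace E] {Y : Ω → ℝ} {X : Ω → E} {x : E} {h : E → ℝ}
    (hY : Integrable Y P) (hX : Measurable X)
    (hcond : P[Y | MeasurableSpace.comap X inferInstance] =ᵐ[P] fun ω ↦ h (X ω))
    (hc : ContinuousAt h x) (hpos : ∀ ε > 0, 0 < P (X ⁻¹' Metric.ball x ε)) :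
    HasCondExpAt P Y X x (h x) := by
  refine ⟨hY, hpos, ?_⟩
  have hm : MeasurableSpace.comap X inferInstance ≤ mΩ := hX.comap_le
  have hint : Integrable (fun ω ↦ h (X ω)) P := integrable_condExp.congr hcond
  rw [Metric.tendsto_nhdsWithin_nhds]
  intro η hη
  obtain ⟨δ, hδ, hh⟩ := Metric.continuousAt_iff.1 hc (η / 2) (half_pos hη)
  refine ⟨δ, hδ, fun ε hε hεδ ↦ ?_⟩
  have hε0 : 0 < ε := hε
  rw [Real.dist_eq, sub_zero, abs_of_pos hε0] at hεδ
  set A := X ⁻¹' Metric.ball x ε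
  have hA : MeasurableSet[MeasurableSpace.comap X inferInstance] A :=
    ⟨_, measurableSet_ball, rfl⟩
  have hA' : MeasurableSet A := hm _ hA
  have hPA : 0 < P.real A := ENNReal.toReal_pos (hpos ε hε0).ne' (measure_ne_top _ _)
  -- `A` belongs to the conditioning σ-algebra, so `Y` can be replaced by `h ∘ X`, which on `A` is
  -- within `η / 2` of `h x`.
  have e1 : ∫ ω in A, Y ω ∂P = ∫ ω in A, h (X ω) ∂P := by
    rw [← setIntegral_condExp hm hY hA]
    exact setIntegral_congr_ae hA' (hcond.mono fun ω hω _ ↦ hω)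
  have e2 : ∫ ω in A, (h (X ω) - h x) ∂P = ∫ ω in A, h (X ω) ∂P - P.real A * h x := by
    rw [integral_sub hint.integrableOn (integrable_const _), setIntegral_const, smul_eq_mul]
  have e3 : ‖∫ ω in A, (h (X ω) - h x) ∂P‖ ≤ η / 2 * P.real A := by
    refine norm_setIntegral_le_of_norm_le_const (measure_lt_top _ _) fun ω hω ↦ ?_
    have : dist (X ω) x < δ := (Metric.mem_ball.1 hω).trans hεδ
    have := hh this
    rw [dist_eq_norm] at this
    exact this.le
  rw [e2, Real.norm_eq_abs] at e3
  rw [e1, Real.dist_eq]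
  have e4 : (∫ ω in A, h (X ω) ∂P) / P.real A - h x =
      (∫ ω in A, h (X ω) ∂P - P.real A * h x) / P.real A := by
    field_simp
  rw [e4, abs_div, abs_of_pos hPA, div_lt_iff₀ hPA]
  nlinarith

end Conditioning

end MEDC

/-! ### The conditional expectation formula -/

open MEDC in
theorem mainTheorem3 {Ω : Type*} [MeasurableSpace Ω] (P : Measure Ω) [IsProbabilityMeasure P]
    {d : ℕ} (W : Fin d → ℝ≥0 → Ω → ℝ) (hW : MEDC.IsStandardBrownian P W)
    (σ : Fin d → ℝ) (hσ : ∀ k, σ k ≠ 0) (z : Fin d → ℝ) (hz : ∀ k, 0 < z k)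
    (T : ℝ≥0) (S : Fin d → ℝ≥0 → Ω → ℝ)
    (hS : MEDC.IsSolution P (MEDC.brownianFiltration P W hW.measurable) W
      (fun _ ↦ Matrix.diagonal σ) z T S)
    (s t : ℝ≥0) (hs : 0 < s) (hst : s < t) (htT : t ≤ T)
    (g : (Fin d → ℝ) → ℝ) (hg : MEDC.PolyGrowth g) :
    (∀ x : Fin d → ℝ, (∀ k, 0 < x k) →
      Integrable (MEDC.opIntegrand W S σ s t g x) P ∧
      Integrable (MEDC.opIntegrand W S σ s t (fun _ ↦ 1) x) P ∧
      MEDC.op P W S σ s t (fun _ ↦ 1) x ≠ 0 ∧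
      MEDC.HasCondExpAt P (fun ω ↦ g (fun k ↦ S k t ω)) (fun ω k ↦ S k s ω) x
        (MEDC.op P W S σ s t g x / MEDC.op P W S σ s t (fun _ ↦ 1) x)) ∧
    P[fun ω ↦ g (fun k ↦ S k t ω) |
        MeasurableSpace.comap (fun ω (k : Fin d) ↦ S k s ω) inferInstance] =ᵐ[P]
      fun ω ↦ MEDC.op P W S σ s t g (fun k ↦ S k s ω) /
        MEDC.op P W S σ s t (fun _ ↦ 1) (fun k ↦ S k s ω) := by
  set v : ℝ≥0 := t - s with hv_def
  have hs0 : s ≠ 0 := hs.ne'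
  have hv0 : v ≠ 0 := (tsub_pos_of_lt hst).ne'
  have hvc : (v : ℝ) = (t : ℝ) - s := NNReal.coe_sub hst.le
  have hsT : s ≤ T := hst.le.trans htT
  have hpair := hW.measurePreserving_brownianPair hst.le
  rw [← hv_def] at hpair
  set Z := brownianPair W s t
  have hSs : ∀ᵐ ω ∂P, (fun k ↦ S k s ω) = gbm σ z s (Z ω).1 := by
    filter_upwards [ae_all_iff.2 fun k ↦ hS.ae_eq_expMartingale hW k hsT] with ω hω
    exact funext hω
  have hSt : ∀ᵐ ω ∂P, (fun k ↦ S k t ω) = gbm σ z t ((Z ω).1 + (Z ω).2) := by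
    filter_upwards [ae_all_iff.2 fun k ↦ hS.ae_eq_expMartingale hW k htT] with ω hω
    funext k
    simp [hω k, gbm, expMartingale, Z, brownianPair]
  have hSm : Measurable fun ω (k : Fin d) ↦ S k s ω :=
    measurable_pi_lambda _ fun k ↦ (hS.adapted k s hsT).mono
      ((brownianFiltration P W hW.measurable).le s) le_rfl
  have hone : PolyGrowth (fun _ : Fin d → ℝ ↦ (1 : ℝ)) :=
    ⟨measurable_const, 1, one_pos, 0, by simp⟩
  have hop_ae (f : (Fin d → ℝ) → ℝ) (x : Fin d → ℝ) : opIntegrand W S σ s t f x =ᵐ[P]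
      fun ω ↦ f (gbm σ z t ((Z ω).1 + (Z ω).2)) * weightProd σ z s v x (Z ω) := by
    filter_upwards [hSs, hSt] with ω h1 h2
    rw [opIntegrand, h2, weightProd]
    congr 1
    refine Finset.prod_congr rfl fun k _ ↦ ?_
    rw [← congrFun h1 k, hvc]
    simp [bridgeWeight, Z, brownianPair]
  have hop_int {f : (Fin d → ℝ) → ℝ} (hf : PolyGrowth f) (x : Fin d → ℝ) :
      Integrable (opIntegrand W S σ s t f x) P :=
    (hpair.integrable_comp_of_integrable
      (hf.integrable_mul_weightProd hσ hz t hs0 hv0 x)).congr (hop_ae f x).symm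
  -- The prefactor is the density of $S_s$ at `x`; it does not depend on `f` and cancels in the
  -- ratio.
  have hop_eq {f : (Fin d → ℝ) → ℝ} (hf : PolyGrowth f) {x a : Fin d → ℝ}
      (ha : gbm σ z s a = x) : op P W S σ s t f x =
      (∏ k, gaussianPDFReal 0 s (a k) / (|σ k| * x k)) * transitionMean σ z t v f a := by
    rw [op, integral_congr_ae (hop_ae f x), ← hf.integral_mul_weightProd hσ hz t hs0 hv0 ha,
      ← hpair.map_eq, integral_map hpair.aemeasurable]
    rw [hpair.map_eq]
    exact (hf.integrable_mul_weightProd hσ hz t hs0 hv0 x).aestronglyMeasurable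
  have hdens {x a : Fin d → ℝ} (ha : gbm σ z s a = x) :
      0 < ∏ k, gaussianPDFReal 0 s (a k) / (|σ k| * x k) := by
    refine Finset.prod_pos fun k _ ↦ div_pos (gaussianPDFReal_pos _ _ _ hs0)
      (mul_pos (abs_pos.2 (hσ k)) ?_)
    rw [← ha]
    exact gbm_pos hz s a k
  have hmean_one a : transitionMean σ z t v (fun _ ↦ 1) a = 1 := by simp [transitionMean]
  have hop_one {x a : Fin d → ℝ} (ha : gbm σ z s a = x) : op P W S σ s t (fun _ ↦ 1) x ≠ 0 := by
    rw [hop_eq hone ha, hmean_one, mul_one]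
    exact (hdens ha).ne'
  have hratio {x a : Fin d → ℝ} (ha : gbm σ z s a = x) :
      op P W S σ s t g x / op P W S σ s t (fun _ ↦ 1) x = transitionMean σ z t v g a := by
    rw [hop_eq hone ha, hop_eq hg ha, hmean_one, mul_one, mul_div_cancel_left₀ _ (hdens ha).ne']
  set Γ := transitionMean σ z t v g
  have hΓc : Continuous Γ := hg.continuous_transitionMean hz t hv0
  -- The logarithm in `gbmInv` is meaningful only on the positive orthant, where $S_s$ lies almost
  -- surely.
  set h : (Fin d → ℝ) → ℝ := fun x ↦ Γ (gbmInv σ z s x) with hh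
  have hhS : ∀ᵐ ω ∂P, h (fun k ↦ S k s ω) = Γ (Z ω).1 := by
    filter_upwards [hSs] with ω hω
    rw [hh, hω]
    simp only [gbmInv_gbm hσ hz]
  have hgint := hg.integrable_comp_gbm_add (σ := σ) hz t s v
  have hYint : Integrable (fun ω ↦ g (fun k ↦ S k t ω)) P := by
    refine (hpair.integrable_comp_of_integrable hgint).congr ?_
    filter_upwards [hSt] with ω hω
    simp [hω]
  have hΓint : Integrable (fun p : (Fin d → ℝ) × (Fin d → ℝ) ↦ Γ p.1)
      ((gaussianPi d s).prod (gaussianPi d v)) := hgint.integral_prod_left.comp_fst _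
  have hhint : Integrable (fun ω ↦ h (fun k ↦ S k s ω)) P := by
    refine (hpair.integrable_comp_of_integrable hΓint).congr ?_
    filter_upwards [hhS] with ω hω
    simp [hω]
  have hcond : P[fun ω ↦ g (fun k ↦ S k t ω) |
      MeasurableSpace.comap (fun ω (k : Fin d) ↦ S k s ω) inferInstance] =ᵐ[P]
      fun ω ↦ h (fun k ↦ S k s ω) := by
    symm
    refine ae_eq_condExp_of_forall_setIntegral_eq hSm.comap_le hYint
      (fun _ _ _ ↦ hhint.integrableOn) ?_ ?_
    · rintro _ ⟨A, hA, rfl⟩ -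
      set A' : Set (Fin d → ℝ) := gbm σ z s ⁻¹' A
      have hA' : MeasurableSet A' := (continuous_gbm σ z s).measurable hA
      -- Up to null sets, events of $\sigma(S_s)$ concern $W_s$ alone, so Fubini integrates out the
      -- independent increment.
      have hset : (fun ω (k : Fin d) ↦ S k s ω) ⁻¹' A =ᵐ[P] Z ⁻¹' (A' ×ˢ Set.univ) := by
        filter_upwards [hSs] with ω hω
        refine propext ?_
        change (fun k ↦ S k s ω) ∈ A ↔ Z ω ∈ A' ×ˢ Set.univ
        simp [hω, A']
      have hAu : MeasurableSet (A' ×ˢ (Set.univ : Set (Fin d → ℝ))) := hA'.prod MeasurableSet.univ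
      have key (f : (Fin d → ℝ) × (Fin d → ℝ) → ℝ) (hf : Integrable f
          ((gaussianPi d s).prod (gaussianPi d v))) : ∫ ω in Z ⁻¹' (A' ×ˢ Set.univ), f (Z ω) ∂P =
          ∫ y in A', ∫ w, f (y, w) ∂gaussianPi d v ∂gaussianPi d s := by
        have h1 := setIntegral_map (μ := P) (f := f) (g := Z) hAu
          (by rw [hpair.map_eq]; exact hf.aestronglyMeasurable) hpair.aemeasurable
        rw [← h1, hpair.map_eq, setIntegral_prod _ hf.integrableOn]
        simp
      calc ∫ ω in (fun ω (k : Fin d) ↦ S k s ω) ⁻¹' A, h (fun k ↦ S k s ω) ∂P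
          = ∫ ω in Z ⁻¹' (A' ×ˢ Set.univ), Γ (Z ω).1 ∂P := by
            rw [setIntegral_congr_set hset]
            exact setIntegral_congr_ae (hpair.measurable hAu) (hhS.mono fun ω hω _ ↦ hω)
        _ = ∫ ω in Z ⁻¹' (A' ×ˢ Set.univ), g (gbm σ z t ((Z ω).1 + (Z ω).2)) ∂P := by
            rw [key (fun p ↦ Γ p.1) hΓint, key (fun p ↦ g (gbm σ z t (p.1 + p.2))) hgint]
            simp [Γ, transitionMean]
        _ = ∫ ω in (fun ω (k : Fin d) ↦ S k s ω) ⁻¹' A, g (fun k ↦ S k t ω) ∂P := by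
            rw [setIntegral_congr_set hset]
            exact setIntegral_congr_ae (hpair.measurable hAu)
              (hSt.mono fun ω hω _ ↦ by simp only [hω])
    · refine Measurable.aestronglyMeasurable ?_
      exact (hΓc.measurable.comp (measurable_gbmInv σ z s)).comp (comap_measurable _)
  refine ⟨fun x hx ↦ ?_, ?_⟩
  · have ha := gbm_gbmInv hσ hz s hx
    refine ⟨hop_int hg x, hop_int hone x, hop_one ha, ?_⟩
    rw [hratio ha]
    refine hasCondExpAt_of_condExp_ae_eq (h := h) hYint hSm hcond
      (hΓc.continuousAt.comp (continuousAt_gbmInv hz s hx)) fun ε hε ↦ ?_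
    have hset : (fun ω (k : Fin d) ↦ S k s ω) ⁻¹' Metric.ball x ε =ᵐ[P]
        (fun ω ↦ (Z ω).1) ⁻¹' (gbm σ z s ⁻¹' Metric.ball x ε) := by
      filter_upwards [hSs] with ω hω
      refine propext ?_
      change (fun k ↦ S k s ω) ∈ Metric.ball x ε ↔ gbm σ z s (Z ω).1 ∈ Metric.ball x ε
      rw [hω]
    have hopen : IsOpen (gbm σ z s ⁻¹' Metric.ball x ε) :=
      Metric.isOpen_ball.preimage (continuous_gbm σ z s)
    have hfst : MeasurePreserving (fun ω ↦ (Z ω).1) P (gaussianPi d s) :=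
      measurePreserving_fst.comp hpair
    rw [measure_congr hset, hfst.measure_preimage hopen.measurableSet.nullMeasurableSet]
    have := isOpenPosMeasure_gaussianPi d hs0
    exact hopen.measure_pos _ ⟨gbmInv σ z s x, by simp [ha, hε]⟩
  · filter_upwards [hcond, hSs] with ω h1 h2
    rw [h1, hratio h2.symm, hh]
    simp only [h2, gbmInv_gbm hσ hz]
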